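/- Let $p>1$ be a real number and let $G$ be a countably infinite, connected graph of bounded degree without self-loops, with vertex set $V$; write $N_x$ for the set of neighbors of $x\in V$, and fix a vertex $o\in V$. For $f:V\to\mathbb R$ put $$I_p(f,V)=\sum_{x\in V}\sum_{y\in N_x}|f(y)-f(x)|^p,\qquad \Delta_pf(x)=\sum_{y\in N_x}|f(y)-f(x)|^{p-2}(f(y)-f(x)),$$ where a summand of $\Delta_p f(x)$ with $f(y)=f(x)$ is read as $0$; $f$ is called $p$-harmonic on $V$ if $\Delta_pf(x)=0$ for all $x\in V$. Let $D_p(G)=\{f:V\to\mathbb R\mid I_p(f,V)<\infty\}$ with the norm $\|f\|_{D_p}=(I_p(f,V)+|f(o)|^p)^{1/p}$, and let $BD_p(G)$ be the algebra of bounded functions in $D_p(G)$. Let $Sp(BD_p(G))$ be the set of nonzero algebra homomorphisms $BD_p(G)\to\mathbb C$ with the weak-$*$ topology (the topology of pointwise convergence on $BD_p(G)$), and let $i:V\to Sp(BD_p(G))$ be the map $i(x)(f)=f(x)$. The $p$-harmonic boundary is the subspace $$\partial_p(G)=\{\tau\in Sp(BD_p(G))\setminus i(V)\mid \tau(f)=0\text{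 for every bounded } f \text{ in the closure in } D_p(G) \text{ of the finitely supported functions}\}.$$ Theorem. For every continuous function $f:\partial_p(G)\to\mathbb R$ there is a $p$-harmonic function $h:V\to\mathbb R$ that extends $f$ continuously: for every $x\in\partial_p(G)$ and every $\varepsilon>0$ there is a neighborhood $U$ of $x$ in $Sp(BD_p(G))$ such that $|h(y)-f(x)|<\varepsilon$ for all $y\in V$ with $i(y)\in U$. In particular, $\lim_{n\to\infty}h(x_n)=f(x)$ for every $x\in\partial_p(G)$ and every sequence $(x_n)$ in $V$ such that $i(x_n)$ converges to $x$ in $Sp(BD_p(G))$. -/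

import Mathlib

open Filter Topology
open scoped ENNReal

noncomputable section

namespace PRoyden

variable {V : Type*} (G : SimpleGraph V) [G.LocallyFinite] (p : ℝ)

/-- The `p`-th power of the gradient, `|Df(x)|^p = ∑_{y ∈ N_x} |f(y) - f(x)|^p`. -/
def gradPow (f : V → ℝ) (x : V) : ℝ :=
  ∑ y ∈ G.neighborFinset x, |f y - f x| ^ p

/-- The `p`-Dirichlet sum `I_p(f, V) = ∑_{x ∈ V} |Df(x)|^p`, with values in `[0, ∞]`. -/
def dirichletSum (f : V → ℝ) : ℝ≥0∞ :=
  ∑' x, ENNReal.ofReal (gradPow G p f x)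

/-- The `p`-Laplacian `Δ_p f(x) = ∑_{y ∈ N_x} |f(y) - f(x)|^(p-2) (f(y) - f(x))`; a summand with
`f y = f x` is zero because of its second factor, also when `p < 2`. -/
def pLaplacian (f : V → ℝ) (x : V) : ℝ :=
  ∑ y ∈ G.neighborFinset x, |f y - f x| ^ (p - 2) * (f y - f x)

/-- `f` is `p`-harmonic on `V`. -/
def IsPHarmonic (f : V → ℝ) : Prop :=
  ∀ x, pLaplacian G p f x = 0

/-- `f` is bounded on `V`, that is, `f ∈ ℓ^∞(G)`. -/
def IsBdd (f : V → ℝ) : Prop :=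
  ∃ C : ℝ, ∀ x, |f x| ≤ C

/-- The norm of `D_p(G)`, `(I_p(f, V) + |f(o)|^p)^(1/p)`, with the value `∞` when `f` is not
`p`-Dirichlet finite. -/
def dpNorm (o : V) (f : V → ℝ) : ℝ≥0∞ :=
  (dirichletSum G p f + ENNReal.ofReal (|f o| ^ p)) ^ (1 / p)

/-- `f` belongs to the closure of the finitely supported functions in `D_p(G)`, the closure
being taken for the norm of `D_p(G)` with base vertex `o`. -/
def InClosureFinSupp (o : V) (f : V → ℝ) : Prop :=
  dirichletSum G p f < ∞ ∧
    ∀ ε : ℝ≥0∞, 0 < ε → ∃ g : V → ℝ, (Function.support g).Finite ∧ dpNorm G p o (f - g) < ε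

variable {p}

theorem gradPow_nonneg (f : V → ℝ) (x : V) : 0 ≤ gradPow G p f x :=
  Finset.sum_nonneg fun _ _ => Real.rpow_nonneg (abs_nonneg _) _

theorem rpow_le_of_abs_le (hp : 1 < p) {a b c u v : ℝ} (ha : 0 ≤ a) (hb : 0 ≤ b)
    (h : |c| ≤ a * |u| + b * |v|) :
    |c| ^ p ≤ (2 * a) ^ p * |u| ^ p + (2 * b) ^ p * |v| ^ p := by
  have hp0 : (0 : ℝ) ≤ p := by linarith
  have hu : 0 ≤ a * |u| := by positivity
  have hv : 0 ≤ b * |v| := by positivity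
  rw [← Real.mul_rpow (by positivity) (abs_nonneg u), ← Real.mul_rpow (by positivity) (abs_nonneg v)]
  have h1 : (0 : ℝ) ≤ (2 * a * |u|) ^ p := Real.rpow_nonneg (by positivity) _
  have h2 : (0 : ℝ) ≤ (2 * b * |v|) ^ p := Real.rpow_nonneg (by positivity) _
  rcases le_total (a * |u|) (b * |v|) with hle | hle
  · have := Real.rpow_le_rpow (abs_nonneg c) (show |c| ≤ 2 * b * |v| by nlinarith) hp0
    linarith
  · have := Real.rpow_le_rpow (abs_nonneg c) (show |c| ≤ 2 * a * |u| by nlinarith) hp0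
    linarith

theorem dirichletSum_lt_top_of_le (hp : 1 < p) {f g k : V → ℝ} {a b : ℝ} (ha : 0 ≤ a)
    (hb : 0 ≤ b) (h : ∀ x y, |k y - k x| ≤ a * |f y - f x| + b * |g y - g x|)
    (hf : dirichletSum G p f < ∞) (hg : dirichletSum G p g < ∞) :
    dirichletSum G p k < ∞ := by
  have hA : (0 : ℝ) ≤ (2 * a) ^ p := Real.rpow_nonneg (by positivity) _
  have hB : (0 : ℝ) ≤ (2 * b) ^ p := Real.rpow_nonneg (by positivity) _
  have key : ∀ x, ENNReal.ofReal (gradPow G p k x) ≤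
      ENNReal.ofReal ((2 * a) ^ p) * ENNReal.ofReal (gradPow G p f x) +
      ENNReal.ofReal ((2 * b) ^ p) * ENNReal.ofReal (gradPow G p g x) := by
    intro x
    rw [← ENNReal.ofReal_mul hA, ← ENNReal.ofReal_mul hB, ← ENNReal.ofReal_add
      (mul_nonneg hA (gradPow_nonneg G f x)) (mul_nonneg hB (gradPow_nonneg G g x))]
    apply ENNReal.ofReal_le_ofReal
    unfold gradPow
    rw [Finset.mul_sum, Finset.mul_sum, ← Finset.sum_add_distrib]
    exact Finset.sum_le_sum fun y _ => rpow_le_of_abs_le hp ha hb (h x y)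
  refine lt_of_le_of_lt (ENNReal.tsum_le_tsum key) ?_
  rw [ENNReal.tsum_add, ENNReal.tsum_mul_left, ENNReal.tsum_mul_left]
  exact ENNReal.add_lt_top.2 ⟨ENNReal.mul_lt_top ENNReal.ofReal_lt_top hf,
    ENNReal.mul_lt_top ENNReal.ofReal_lt_top hg⟩

theorem dirichletSum_const (hp : 1 < p) (c : ℝ) : dirichletSum G p (fun _ => c) = 0 := by
  have hp0 : p ≠ 0 := by linarith
  simp [dirichletSum, gradPow, Real.zero_rpow hp0]

/-- The algebra `BD_p(G)` of bounded `p`-Dirichlet finite real functions on `V`, with pointwise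
operations. -/
def BD (hp : 1 < p) : Subalgebra ℝ (V → ℝ) where
  carrier := {f | dirichletSum G p f < ∞ ∧ IsBdd f}
  mul_mem' := by
    rintro f g ⟨hf, A, hA⟩ ⟨hg, B, hB⟩
    refine ⟨dirichletSum_lt_top_of_le G hp (abs_nonneg B) (abs_nonneg A) ?_ hf hg,
      |A| * |B|, fun x => ?_⟩
    · intro x y
      have e : (f * g) y - (f * g) x = g y * (f y - f x) + f x * (g y - g x) := by
        simp only [Pi.mul_apply]; ring
      rw [e]
      refine (abs_add_le _ _).trans ?_
      rw [abs_mul, abs_mul]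
      exact add_le_add
        (mul_le_mul_of_nonneg_right ((hB y).trans (le_abs_self B)) (abs_nonneg _))
        (mul_le_mul_of_nonneg_right ((hA x).trans (le_abs_self A)) (abs_nonneg _))
    · rw [Pi.mul_apply, abs_mul]
      exact mul_le_mul ((hA x).trans (le_abs_self A)) ((hB x).trans (le_abs_self B))
        (abs_nonneg _) (abs_nonneg _)
  add_mem' := by
    rintro f g ⟨hf, A, hA⟩ ⟨hg, B, hB⟩
    refine ⟨dirichletSum_lt_top_of_le G hp zero_le_one zero_le_one ?_ hf hg,
      A + B, fun x => (abs_add_le _ _).trans (add_le_add (hA x) (hB x))⟩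
    intro x y
    have e : (f + g) y - (f + g) x = (f y - f x) + (g y - g x) := by
      simp only [Pi.add_apply]; ring
    rw [e, one_mul, one_mul]
    exact abs_add_le _ _
  algebraMap_mem' := fun c =>
    ⟨(dirichletSum_const G hp c).trans_lt ENNReal.zero_lt_top, |c|, fun _ => le_rfl⟩

/-- The spectrum `Sp(BD_p(G))`: the nonzero algebra homomorphisms from `BD_p(G)` to `ℂ`. -/
def Sp (hp : 1 < p) : Type _ :=
  {τ : BD G hp →ₙₐ[ℝ] ℂ // τ ≠ 0}

/-- The Gelfand transform `f ↦ f̂`, where `f̂(τ) = τ(f)`. -/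
def gelfand (hp : 1 < p) (f : BD G hp) (τ : Sp G hp) : ℂ :=
  τ.1 f

/-- The weak-* topology: the coarsest one that makes every `f̂` continuous. -/
instance Sp.instTopologicalSpace (hp : 1 < p) : TopologicalSpace (Sp G hp) :=
  TopologicalSpace.induced (fun τ f => gelfand G hp f τ) Pi.topologicalSpace

/-- The map `i : V → Sp(BD_p(G))`, `(i(x))(f) = f(x)`. -/
def vertexChar (hp : 1 < p) (x : V) : Sp G hp :=
  ⟨{ toFun := fun f => ((f : V → ℝ) x : ℂ)
     map_smul' := fun c f => by simp
     map_zero' := by simp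
     map_add' := fun f g => by simp
     map_mul' := fun f g => by simp },
   fun h => by
    have h1 := DFunLike.congr_fun h (1 : BD G hp)
    simp [NonUnitalAlgHom.coe_mk] at h1⟩

/-- The `p`-Royden boundary `R_p(G) = Sp(BD_p(G)) \ i(V)`. -/
def roydenBoundary (hp : 1 < p) : Set (Sp G hp) :=
  (Set.range (vertexChar G hp))ᶜ

/-- The `p`-harmonic boundary `∂_p(G)`: the points of the `p`-Royden boundary at which `f̂` vanishes
for every bounded `f` in the `D_p`-closure of the finitely supported functions. -/
def pHarmonicBoundary (hp : 1 < p) (o : V) : Set (Sp G hp) :=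
  {τ | τ ∈ roydenBoundary G hp ∧
    ∀ f : BD G hp, InClosureFinSupp G p o (f : V → ℝ) → gelfand G hp f τ = 0}

end PRoyden

end

/-! On the compact set `∂_p(G)`, the real parts of Gelfand transforms form an algebra with constants
that separates points. By Stone–Weierstrass, `f` is there a uniform limit of boundary values of
functions `k ∈ BD_p(G)`. The Royden decomposition (`exists_royden_decomposition`) replaces `k` by a
bounded `p`-harmonic `h` of finite energy. Since `k - h` lies in the closure of the finitely
supported functions, its transform vanishes on `∂_p(G)`, and `h` has the boundary values of `k`.

The comparison principle (`sub_le_of_gelfand_sub_le`) turns uniform closeness on the boundary into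
uniform closeness on `V`. The functions `h` are therefore uniformly Cauchy. Their limit is
`p`-harmonic because `Δ_p` is at each vertex a finite sum of continuous terms, and it takes the
boundary values `f` because the convergence is uniform. No bound on the energy of the limit is
needed.

The decomposition comes from minimizing the energy over finitely supported perturbations of `k`;
uniform convexity makes minimizing sequences Cauchy in energy.

For the comparison, compactness bounds the positive part of `h₁ - h₂ - c` by a multiple of a finite
sum of absolute values of functions in the closure. It is then a legitimate test function, and
strict monotonicity of `t ↦ |t|^(p-2) t` forces it to be constant. A boundary point excludes a
positive constant. -/

noncomputable section

namespace PRoyden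

section

/-! ### The signed power `t ↦ |t|^(p-2) t` and uniform convexity of `t ↦ |t|^p` -/

/-- The signed power `t ↦ |t|^(p-2) t`, the derivative of `|t|^p / p`. -/
def signedPow (p t : ℝ) : ℝ :=
  |t| ^ (p - 2) * t

theorem signedPow_of_nonneg {p t : ℝ} (hp : 1 < p) (ht : 0 ≤ t) :
    signedPow p t = t ^ (p - 1) := by
  rcases ht.eq_or_lt with rfl | ht
  · simp [signedPow, Real.zero_rpow (show p - 1 ≠ 0 by linarith)]
  · rw [signedPow, abs_of_pos ht, show p - 1 = (p - 2) + 1 by ring, Real.rpow_add_one ht.ne']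

theorem signedPow_neg (p t : ℝ) : signedPow p (-t) = -signedPow p t := by
  simp [signedPow]

theorem abs_signedPow {p : ℝ} (hp : 1 < p) (t : ℝ) : |signedPow p t| = |t| ^ (p - 1) := by
  rw [← signedPow_of_nonneg hp (abs_nonneg t), signedPow, signedPow, abs_mul, abs_abs,
    abs_of_nonneg (Real.rpow_nonneg (abs_nonneg t) _)]

theorem signedPow_strictMono {p : ℝ} (hp : 1 < p) : StrictMono (signedPow p) := by
  have hpos : ∀ {a b : ℝ}, 0 ≤ a → a < b → signedPow p a < signedPow p b := by
    intro a b ha hab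
    rw [signedPow_of_nonneg hp ha, signedPow_of_nonneg hp (ha.trans hab.le)]
    exact Real.rpow_lt_rpow ha hab (by linarith)
  have h0 : signedPow p 0 = 0 := by simp [signedPow]
  intro a b hab
  rcases le_or_gt 0 a with ha | ha
  · exact hpos ha hab
  · rcases le_or_gt b 0 with hb | hb
    · have := hpos (neg_nonneg.2 hb) (neg_lt_neg hab)
      rw [signedPow_neg, signedPow_neg] at this
      linarith
    · have h1 := hpos le_rfl hb
      have h2 := hpos le_rfl (neg_pos.2 ha)
      rw [signedPow_neg] at h2
      linarith

/-- For `p < 2` the factor `|t|^(p-2)` blows up at `0`. Continuity is read off from the `C¹`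
function `|t|^p`, whose derivative is `p` times the signed power. -/
theorem continuous_signedPow {p : ℝ} (hp : 1 < p) : Continuous (signedPow p) := by
  have h : signedPow p = fun t => p⁻¹ * deriv (fun x : ℝ => ‖x‖ ^ p) t := by
    funext t
    have := (hasDerivAt_abs_rpow t hp).deriv
    simp only [Real.norm_eq_abs]
    rw [this, signedPow]
    have : p ≠ 0 := by linarith
    field_simp
  rw [h]
  exact continuous_const.mul ((contDiff_norm_rpow (E := ℝ) hp).continuous_deriv le_rfl)

theorem continuous_abs_rpow {p : ℝ} (hp : 1 < p) : Continuous fun t : ℝ => |t| ^ p :=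
  continuous_abs.rpow_const fun _ => Or.inr (by linarith)

theorem abs_midpoint_rpow_lt {p : ℝ} (hp : 1 < p) {a b : ℝ} (hab : a ≠ b) :
    |(a + b) / 2| ^ p < (|a| ^ p + |b| ^ p) / 2 := by
  have h1 : |(a + b) / 2| ≤ (|a| + |b|) / 2 := by
    rw [abs_div, abs_two]
    linarith [abs_add_le a b]
  by_cases h : |a| = |b|
  -- Strict convexity is available on `[0, ∞)` only and gives nothing when the absolute values
  -- agree; then the midpoint is `0`.
  · have hb : a = -b := by
      rcases abs_eq_abs.1 h with h | h
      · exact absurd h hab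
      · exact h
    subst hb
    have hb0 : b ≠ 0 := by rintro rfl; simp at hab
    have : 0 < |b| ^ p := Real.rpow_pos_of_pos (abs_pos.2 hb0) _
    simp only [neg_add_cancel, zero_div, abs_zero, abs_neg]
    rw [Real.zero_rpow (by linarith)]
    linarith
  · have h2 := (strictConvexOn_rpow hp).2 (Set.mem_Ici.2 (abs_nonneg a))
      (Set.mem_Ici.2 (abs_nonneg b)) h (show (0 : ℝ) < 1 / 2 by norm_num)
      (show (0 : ℝ) < 1 / 2 by norm_num) (by norm_num)
    simp only [smul_eq_mul] at h2
    have h3 := Real.rpow_le_rpow (abs_nonneg _) h1 (show 0 ≤ p by linarith)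
    rw [show (|a| + |b|) / 2 = 1 / 2 * |a| + 1 / 2 * |b| by ring] at h3
    linarith

theorem abs_midpoint_rpow_le {p : ℝ} (hp : 1 < p) (a b : ℝ) :
    |(a + b) / 2| ^ p ≤ (|a| ^ p + |b| ^ p) / 2 := by
  by_cases hab : a = b
  · subst hab
    simp
  · exact (abs_midpoint_rpow_lt hp hab).le

/-- Uniform convexity of `t ↦ |t|^p`, for all `p > 1`. -/
theorem exists_abs_sub_rpow_le {p : ℝ} (hp : 1 < p) {δ : ℝ} (hδ : 0 < δ) :
    ∃ C : ℝ, 0 ≤ C ∧ ∀ a b : ℝ, |a - b| ^ p ≤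
      δ * (|a| ^ p + |b| ^ p) + C * ((|a| ^ p + |b| ^ p) / 2 - |(a + b) / 2| ^ p) := by
  have hc := continuous_abs_rpow hp
  let D : ℝ × ℝ → ℝ := fun z => (|z.1| ^ p + |z.2| ^ p) / 2 - |(z.1 + z.2) / 2| ^ p
  have hD : Continuous D := by
    have h1 : Continuous fun z : ℝ × ℝ => |z.1| ^ p := hc.comp continuous_fst
    have h2 : Continuous fun z : ℝ × ℝ => |z.2| ^ p := hc.comp continuous_snd
    have h3 : Continuous fun z : ℝ × ℝ => |(z.1 + z.2) / 2| ^ p :=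
      hc.comp ((continuous_fst.add continuous_snd).div_const 2)
    exact ((h1.add h2).div_const 2).sub h3
  -- The unit vectors for which the `δ`-term alone may fail. On this compact set the convexity
  -- defect `D` is positive, hence bounded below.
  let K : Set (ℝ × ℝ) := Metric.sphere 0 1 ∩
    {z | δ * (|z.1| ^ p + |z.2| ^ p) ≤ |z.1 - z.2| ^ p}
  have hK : IsCompact K := by
    refine (isCompact_sphere _ _).inter_right (isClosed_le ?_ ?_)
    · exact continuous_const.mul ((hc.comp continuous_fst).add (hc.comp continuous_snd))
    · exact hc.comp (continuous_fst.sub continuous_snd)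
  have hsum : ∀ z ∈ Metric.sphere (0 : ℝ × ℝ) 1, 0 < |z.1| ^ p + |z.2| ^ p := by
    intro z hz
    have h1 : (0 : ℝ) ≤ |z.1| ^ p := Real.rpow_nonneg (abs_nonneg _) _
    have h2 : (0 : ℝ) ≤ |z.2| ^ p := Real.rpow_nonneg (abs_nonneg _) _
    have hz1 : max |z.1| |z.2| = 1 := by
      simpa [Prod.norm_def] using hz
    rcases max_choice |z.1| |z.2| with h | h
    · rw [h] at hz1; rw [hz1]; simp; linarith
    · rw [h] at hz1; rw [hz1]; simp; linarith
  have hDpos : ∀ z ∈ K, 0 < D z := by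
    intro z hz
    have hne : z.1 ≠ z.2 := by
      intro h
      have h1 := hz.2
      have h2 := mul_pos hδ (hsum z hz.1)
      simp only [Set.mem_ofPred_eq, h, sub_self, abs_zero] at h1 h2
      rw [Real.zero_rpow (by linarith)] at h1
      linarith
    exact sub_pos.2 (abs_midpoint_rpow_lt hp hne)
  obtain ⟨d, hd, hdK⟩ : ∃ d > 0, ∀ z ∈ K, d ≤ D z := by
    rcases K.eq_empty_or_nonempty with h | h
    · exact ⟨1, one_pos, by simp [h]⟩
    · obtain ⟨z, hz, hmin⟩ := hK.exists_isMinOn h hD.continuousOn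
      exact ⟨D z, hDpos z hz, fun w hw => hmin hw⟩
  have h2p : (0 : ℝ) ≤ 2 ^ p := by positivity
  -- On `K` one has `|z.1 - z.2| ≤ 2` and `D z ≥ d`, whence the constant `2 ^ p / d`.
  have hunit : ∀ z ∈ Metric.sphere (0 : ℝ × ℝ) 1,
      |z.1 - z.2| ^ p ≤ δ * (|z.1| ^ p + |z.2| ^ p) + 2 ^ p / d * D z := by
    intro z hz
    have hC : 0 ≤ 2 ^ p / d := by positivity
    have hD0 : 0 ≤ D z := sub_nonneg.2 (abs_midpoint_rpow_le hp _ _)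
    by_cases h : z ∈ K
    · have hz1 : max |z.1| |z.2| = 1 := by
        simpa [Prod.norm_def] using hz
      have h1 : |z.1 - z.2| ≤ 2 := by
        have := abs_sub z.1 z.2
        have := le_max_left |z.1| |z.2|
        have := le_max_right |z.1| |z.2|
        linarith
      have h2 := Real.rpow_le_rpow (abs_nonneg _) h1 (show 0 ≤ p by linarith)
      have h3 : (2 : ℝ) ^ p ≤ 2 ^ p / d * D z := by
        rw [div_mul_eq_mul_div, le_div_iff₀ hd]
        exact mul_le_mul_of_nonneg_left (hdK z h) h2p
      have := mul_pos hδ (hsum z hz)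
      linarith
    · have h1 : |z.1 - z.2| ^ p < δ * (|z.1| ^ p + |z.2| ^ p) := by
        by_contra! h'
        exact h ⟨hz, h'⟩
      have := mul_nonneg hC hD0
      linarith
  refine ⟨2 ^ p / d, by positivity, fun a b => ?_⟩
  by_cases h0 : ((a, b) : ℝ × ℝ) = 0
  · obtain ⟨rfl, rfl⟩ := Prod.mk.inj h0
    simp [Real.zero_rpow (show p ≠ 0 by linarith)]
  -- All terms are homogeneous of degree `p`, so the unit sphere suffices.
  · set r := ‖((a, b) : ℝ × ℝ)‖ with hr
    have hr0 : 0 < r := norm_pos_iff.2 h0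
    have hz : ((a / r, b / r) : ℝ × ℝ) ∈ Metric.sphere (0 : ℝ × ℝ) 1 := by
      have : ((a / r, b / r) : ℝ × ℝ) = r⁻¹ • (a, b) := by
        ext <;> simp [div_eq_inv_mul]
      rw [mem_sphere_zero_iff_norm, this, norm_smul, ← hr, norm_inv, Real.norm_eq_abs,
        abs_of_pos hr0, inv_mul_cancel₀ hr0.ne']
    have hs : ∀ t : ℝ, |t / r| ^ p = |t| ^ p / r ^ p := by
      intro t
      rw [abs_div, abs_of_pos hr0, Real.div_rpow (abs_nonneg _) hr0.le]
    have h := hunit _ hz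
    simp only [D] at h
    rw [← sub_div, ← add_div, div_right_comm, hs, hs, hs, hs] at h
    have hrp : 0 < r ^ p := Real.rpow_pos_of_pos hr0 _
    have h' := mul_le_mul_of_nonneg_right h hrp.le
    rw [div_mul_cancel₀ _ hrp.ne'] at h'
    refine h'.trans_eq ?_
    field_simp

/-! ### The gradient as a function on ordered pairs -/

variable {V : Type*} (G : SimpleGraph V)

open Classical in
/-- The gradient of `f`, as a function on ordered pairs of vertices. -/
def grad (f : V → ℝ) (e : V × V) : ℝ :=
  if G.Adj e.1 e.2 then f e.2 - f e.1 else 0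

theorem grad_of_adj {x y : V} (h : G.Adj x y) (f : V → ℝ) : grad G f (x, y) = f y - f x :=
  if_pos h

theorem grad_add (f g : V → ℝ) (e : V × V) : grad G (f + g) e = grad G f e + grad G g e := by
  unfold grad
  split_ifs
  · simp only [Pi.add_apply]; ring
  · simp

theorem grad_sub (f g : V → ℝ) (e : V × V) : grad G (f - g) e = grad G f e - grad G g e := by
  unfold grad
  split_ifs
  · simp only [Pi.sub_apply]; ring
  · simp

theorem grad_smul (c : ℝ) (f : V → ℝ) (e : V × V) : grad G (c • f) e = c * grad G f e := by
  unfold grad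
  split_ifs
  · simp only [Pi.smul_apply, smul_eq_mul]; ring
  · simp

theorem abs_grad_le {f g : V → ℝ} (h : ∀ x y, |g y - g x| ≤ |f y - f x|) (e : V × V) :
    |grad G g e| ≤ |grad G f e| := by
  unfold grad
  split_ifs
  · exact h _ _
  · simp

theorem tendsto_grad {ι : Type*} {l : Filter ι} {g : ι → V → ℝ} {f : V → ℝ}
    (h : ∀ x, Tendsto (fun i => g i x) l (𝓝 (f x))) (e : V × V) :
    Tendsto (fun i => grad G (g i) e) l (𝓝 (grad G f e)) := by
  unfold grad
  split_ifs
  · exact (h _).sub (h _)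
  · exact tendsto_const_nhds

theorem finite_support_grad [G.LocallyFinite] {v : V → ℝ} (hv : v.support.Finite) :
    (grad G v).support.Finite := by
  have h1 : (⋃ x ∈ v.support, ({x} : Set V) ×ˢ (G.neighborSet x)).Finite :=
    hv.biUnion fun x _ => (Set.finite_singleton x).prod (Set.toFinite _)
  refine (h1.union (h1.preimage Prod.swap_injective.injOn)).subset ?_
  rintro ⟨x, y⟩ hxy
  have hadj : G.Adj x y := by
    by_contra h
    exact hxy (if_neg h)
  have hne : v y - v x ≠ 0 := by
    rw [← grad_of_adj G hadj]
    exact hxy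
  by_cases hx : v x = 0
  · have hy : v y ≠ 0 := by
      rintro hy
      simp [hx, hy] at hne
    right
    simp [hy, hadj.symm]
  · left
    simp [hx, hadj]

/-- `f` has finite `p`-energy at most `B`. -/
def EnergyLE (p : ℝ) (f : V → ℝ) (B : ℝ) : Prop :=
  ∀ S : Finset (V × V), ∑ e ∈ S, |grad G f e| ^ p ≤ B

variable {G} {p : ℝ}

theorem EnergyLE.nonneg {f : V → ℝ} {B : ℝ} (h : EnergyLE G p f B) : 0 ≤ B := by
  simpa using h ∅

theorem EnergyLE.summable {f : V → ℝ} {B : ℝ} (h : EnergyLE G p f B) :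
    Summable fun e => |grad G f e| ^ p :=
  summable_of_sum_le (fun _ => Real.rpow_nonneg (abs_nonneg _) _) h

theorem EnergyLE.tsum_le {f : V → ℝ} {B : ℝ} (h : EnergyLE G p f B) :
    ∑' e, |grad G f e| ^ p ≤ B :=
  Real.tsum_le_of_sum_le (fun _ => Real.rpow_nonneg (abs_nonneg _) _) h

theorem energyLE_tsum {f : V → ℝ} (h : Summable fun e => |grad G f e| ^ p) :
    EnergyLE G p f (∑' e, |grad G f e| ^ p) :=
  fun S => h.sum_le_tsum S fun _ _ => Real.rpow_nonneg (abs_nonneg _) _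

theorem EnergyLE.mono (hp : 1 < p) {f g : V → ℝ} {B : ℝ} (h : EnergyLE G p f B)
    (hfg : ∀ e, |grad G g e| ≤ |grad G f e|) : EnergyLE G p g B := fun S =>
  (Finset.sum_le_sum fun e _ =>
    Real.rpow_le_rpow (abs_nonneg _) (hfg e) (by linarith)).trans (h S)

/-- Fatou's lemma for the `p`-energy. -/
theorem EnergyLE.of_tendsto (hp : 1 < p) {ι : Type*} {l : Filter ι} [l.NeBot] {g : ι → V → ℝ}
    {f : V → ℝ} (hg : ∀ x, Tendsto (fun i => g i x) l (𝓝 (f x))) {B : ℝ}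
    (hB : ∀ᶠ i in l, EnergyLE G p (g i) B) : EnergyLE G p f B := fun S =>
  le_of_tendsto (tendsto_finsetSum S fun e _ =>
    ((continuous_abs_rpow hp).tendsto _).comp (tendsto_grad G hg e)) (hB.mono fun _ h => h S)

/-- The energy of a function whose gradient is dominated by the sum of two gradients. -/
theorem EnergyLE.of_le_add (hp : 1 < p) {f g k : V → ℝ} {A B : ℝ} (hf : EnergyLE G p f A)
    (hg : EnergyLE G p g B) (h : ∀ e, |grad G k e| ≤ |grad G f e| + |grad G g e|) :
    EnergyLE G p k (2 ^ p * A + 2 ^ p * B) := by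
  intro S
  have h2 : (0 : ℝ) ≤ 2 ^ p := by positivity
  calc ∑ e ∈ S, |grad G k e| ^ p
      ≤ ∑ e ∈ S, (2 ^ p * |grad G f e| ^ p + 2 ^ p * |grad G g e| ^ p) :=
        Finset.sum_le_sum fun e _ => by
          simpa using rpow_le_of_abs_le hp zero_le_one zero_le_one (by simpa using h e)
    _ = 2 ^ p * ∑ e ∈ S, |grad G f e| ^ p + 2 ^ p * ∑ e ∈ S, |grad G g e| ^ p := by
        rw [Finset.sum_add_distrib, Finset.mul_sum, Finset.mul_sum]
    _ ≤ _ := add_le_add (mul_le_mul_of_nonneg_left (hf S) h2)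
        (mul_le_mul_of_nonneg_left (hg S) h2)

theorem EnergyLE.add (hp : 1 < p) {f g : V → ℝ} {A B : ℝ} (hf : EnergyLE G p f A)
    (hg : EnergyLE G p g B) : EnergyLE G p (f + g) (2 ^ p * A + 2 ^ p * B) :=
  hf.of_le_add hp hg fun e => by rw [grad_add]; exact abs_add_le _ _

theorem EnergyLE.sub (hp : 1 < p) {f g : V → ℝ} {A B : ℝ} (hf : EnergyLE G p f A)
    (hg : EnergyLE G p g B) : EnergyLE G p (f - g) (2 ^ p * A + 2 ^ p * B) :=
  hf.of_le_add hp hg fun e => by rw [grad_sub]; exact abs_sub _ _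

theorem EnergyLE.smul (c : ℝ) {f : V → ℝ} {A : ℝ} (hf : EnergyLE G p f A) :
    EnergyLE G p (c • f) (|c| ^ p * A) := by
  intro S
  have : ∀ e, |grad G (c • f) e| ^ p = |c| ^ p * |grad G f e| ^ p := by
    intro e
    rw [grad_smul, abs_mul, Real.mul_rpow (abs_nonneg _) (abs_nonneg _)]
  simp only [this, ← Finset.mul_sum]
  exact mul_le_mul_of_nonneg_left (hf S) (Real.rpow_nonneg (abs_nonneg _) _)

theorem EnergyLE.of_finite_support [G.LocallyFinite] (hp : 1 < p) {v : V → ℝ}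
    (hv : v.support.Finite) : EnergyLE G p v (∑' e, |grad G v e| ^ p) := by
  refine energyLE_tsum (summable_of_hasFiniteSupport ((finite_support_grad G hv).subset ?_))
  intro e he h
  simp [h, Real.zero_rpow (show p ≠ 0 by linarith)] at he

variable (G) [G.LocallyFinite]

theorem dirichletSum_eq_tsum_grad (hp : 1 < p) (f : V → ℝ) :
    dirichletSum G p f = ∑' e, ENNReal.ofReal (|grad G f e| ^ p) := by
  have hp0 : p ≠ 0 := by linarith
  rw [dirichletSum, ENNReal.tsum_prod' (f := fun e => ENNReal.ofReal (|grad G f e| ^ p))]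
  refine tsum_congr fun x => ?_
  rw [tsum_eq_sum (s := G.neighborFinset x), gradPow, ENNReal.ofReal_sum_of_nonneg]
  · refine Finset.sum_congr rfl fun y hy => ?_
    rw [grad_of_adj G (by simpa using hy)]
  · exact fun _ _ => Real.rpow_nonneg (abs_nonneg _) _
  · intro y hy
    have : grad G f (x, y) = 0 := if_neg (by simpa using hy)
    simp [this, Real.zero_rpow hp0]

theorem dirichletSum_lt_top_iff (hp : 1 < p) (f : V → ℝ) :
    dirichletSum G p f < ∞ ↔ ∃ B, EnergyLE G p f B := by
  rw [dirichletSum_eq_tsum_grad G hp]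
  constructor
  · intro h
    refine ⟨_, energyLE_tsum ?_⟩
    have h1 := ENNReal.summable_toReal h.ne
    refine h1.congr fun e => ?_
    rw [ENNReal.toReal_ofReal (Real.rpow_nonneg (abs_nonneg _) _)]
  · rintro ⟨B, hB⟩
    rw [← ENNReal.ofReal_tsum_of_nonneg (fun _ => Real.rpow_nonneg (abs_nonneg _) _) hB.summable]
    exact ENNReal.ofReal_lt_top

theorem dirichletSum_le_ofReal (hp : 1 < p) {f : V → ℝ} {B : ℝ} (h : EnergyLE G p f B) :
    dirichletSum G p f ≤ ENNReal.ofReal B := by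
  rw [dirichletSum_eq_tsum_grad G hp,
    ← ENNReal.ofReal_tsum_of_nonneg (fun _ => Real.rpow_nonneg (abs_nonneg _) _) h.summable]
  exact ENNReal.ofReal_le_ofReal h.tsum_le

theorem energyLE_toReal (hp : 1 < p) {f : V → ℝ} (h : dirichletSum G p f < ∞) :
    EnergyLE G p f (dirichletSum G p f).toReal := by
  obtain ⟨B, hB⟩ := (dirichletSum_lt_top_iff G hp f).1 h
  rw [dirichletSum_eq_tsum_grad G hp,
    ← ENNReal.ofReal_tsum_of_nonneg (fun _ => Real.rpow_nonneg (abs_nonneg _) _) hB.summable,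
    ENNReal.toReal_ofReal (tsum_nonneg fun _ => Real.rpow_nonneg (abs_nonneg _) _)]
  exact energyLE_tsum hB.summable

/-! ### Green's formula -/

theorem pLaplacian_eq_sum (f : V → ℝ) (x : V) :
    pLaplacian G p f x = ∑ y ∈ G.neighborFinset x, signedPow p (grad G f (x, y)) := by
  refine Finset.sum_congr rfl fun y hy => ?_
  rw [grad_of_adj G (by simpa using hy)]
  rfl

/-- Green's formula for a finitely supported test function. -/
theorem hasSum_signedPow_grad_mul_grad (h : V → ℝ) {v : V → ℝ} (hv : v.support.Finite) :
    HasSum (fun e => signedPow p (grad G h e) * grad G v e)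
      (-2 * ∑ x ∈ hv.toFinset, v x * pLaplacian G p h x) := by
  let F : V × V → ℝ := fun e => signedPow p (grad G h e) * v e.1
  have hF : HasSum F (∑ x ∈ hv.toFinset, v x * pLaplacian G p h x) := by
    let S : Finset (V × V) := (hv.toFinset.sigma fun x => G.neighborFinset x).map
      (Equiv.sigmaEquivProd V V).toEmbedding
    have hS : ∑ e ∈ S, F e = ∑ x ∈ hv.toFinset, v x * pLaplacian G p h x := by
      rw [Finset.sum_map, Finset.sum_sigma]
      refine Finset.sum_congr rfl fun x _ => ?_
      rw [pLaplacian_eq_sum, Finset.mul_sum]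
      exact Finset.sum_congr rfl fun y _ => mul_comm _ _
    rw [← hS]
    refine hasSum_sum_of_ne_finset_zero ?_
    rintro ⟨x, y⟩ hxy
    by_cases hadj : G.Adj x y
    · by_cases hvx : v x = 0
      · simp [F, hvx]
      · refine absurd ?_ hxy
        simp only [S, Finset.mem_map_equiv, Finset.mem_sigma]
        simp [hvx, hadj]
    · have : grad G h (x, y) = 0 := if_neg hadj
      simp [F, this, signedPow]
  -- Reversing a pair changes the sign of the gradient of `h`. Both endpoint terms of `grad G v`
  -- thus contribute `-F` up to a swap, which explains the factor `-2`.
  have hF' := (Equiv.prodComm V V).hasSum_iff.2 hF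
  have hgrad : ∀ e : V × V, grad G h e.swap = -grad G h e := by
    rintro ⟨x, y⟩
    by_cases hadj : G.Adj x y
    · rw [grad_of_adj G hadj, Prod.swap_prod_mk, grad_of_adj G hadj.symm, neg_sub]
    · rw [grad, grad, if_neg hadj, if_neg fun h => hadj h.symm, neg_zero]
  have hsum := (hF'.add hF).neg
  rw [← two_mul, ← neg_mul] at hsum
  have hfun : (fun e => signedPow p (grad G h e) * grad G v e) =
      fun e => -((F ∘ Equiv.prodComm V V) e + F e) := by
    funext e
    simp only [F, Function.comp_apply, Equiv.prodComm_apply, hgrad, signedPow_neg]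
    rcases e with ⟨x, y⟩
    by_cases hadj : G.Adj x y
    · simp only [grad_of_adj G hadj, Prod.swap_prod_mk]; ring
    · have : grad G h (x, y) = 0 := if_neg hadj
      simp [this, signedPow]
  rw [hfun]
  exact hsum

end

section

/-! ### The Royden decomposition -/

variable {V : Type*} (G : SimpleGraph V) {p : ℝ}

/-- Truncation is a contraction, so it does not increase the energy; this keeps minimizing sequences
bounded. -/
theorem abs_clamp_sub_clamp_le (a b s t : ℝ) :
    |max a (min s b) - max a (min t b)| ≤ |s - t| := by
  have h1 := abs_max_sub_max_le_max a (min s b) a (min t b)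
  have h2 := abs_min_sub_min_le_max s b t b
  simp only [sub_self, abs_zero] at h1 h2
  rw [max_eq_right (abs_nonneg (min s b - min t b))] at h1
  rw [max_eq_left (abs_nonneg (s - t))] at h2
  exact h1.trans h2

/-- By uniform convexity, a minimizing sequence is a Cauchy sequence. -/
theorem energyLE_sub_of_minimizing (hp : 1 < p) {f : V → ℝ} {m : ℝ} {g : ℕ → V → ℝ} (hm : 0 ≤ m)
    (hfin : ∀ n, (f - g n).support.Finite) (hE : ∀ n : ℕ, EnergyLE G p (g n) (m + 1 / (n + 1)))
    (hmin : ∀ k : V → ℝ, (f - k).support.Finite →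
        (Summable fun e => |grad G k e| ^ p) ∧ m ≤ ∑' e, |grad G k e| ^ p)
    {ε : ℝ} (hε : 0 < ε) : ∃ N, ∀ n ≥ N, ∀ k ≥ N, EnergyLE G p (g n - g k) ε := by
  -- The energies involved are at most `m + 1`, so this `δ` contributes at most `ε / 2`.
  obtain ⟨C, hC, hineq⟩ := exists_abs_sub_rpow_le hp (δ := ε / (4 * (m + 1))) (by positivity)
  obtain ⟨N, hN⟩ := exists_nat_one_div_lt (show 0 < ε / (2 * (C + 1)) by positivity)
  refine ⟨N, fun n hn k hk S => ?_⟩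
  -- The midpoint is again a competitor, so its energy is at least `m`; the total convexity defect
  -- is then at most `1 / (N + 1)`.
  let w : V → ℝ := (1 / 2 : ℝ) • (g n + g k)
  have hw : (f - w).support.Finite := by
    refine ((hfin n).union (hfin k)).subset fun x hx => ?_
    contrapose! hx
    simp only [Set.mem_union, Function.mem_support, Pi.sub_apply, not_or, not_not] at hx ⊢
    simp only [w, Pi.smul_apply, Pi.add_apply, smul_eq_mul]
    linarith [hx.1, hx.2]
  obtain ⟨hws, hwm⟩ := hmin w hw
  have hgw : ∀ e, grad G w e = (grad G (g n) e + grad G (g k) e) / 2 := by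
    intro e
    rw [grad_smul, grad_add]
    ring
  have hs := (hE n).summable.add (hE k).summable
  have hs1 := hs.mul_left (ε / (4 * (m + 1)))
  have hs2 := ((hs.div_const 2).sub hws).mul_left C
  have hle : ∀ j ≥ N, ∑' e, |grad G (g j) e| ^ p ≤ m + 1 / ((N : ℝ) + 1) := fun j hj =>
    (hE j).tsum_le.trans (add_le_add le_rfl (one_div_le_one_div_of_le (by positivity)
      (by exact_mod_cast Nat.succ_le_succ hj)))
  have h1 : (1 : ℝ) / (N + 1) ≤ 1 := by
    rw [div_le_one (by positivity)]
    linarith [show (0 : ℝ) ≤ N from N.cast_nonneg]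
  set t : ℝ := 1 / ((N : ℝ) + 1)
  calc ∑ e ∈ S, |grad G (g n - g k) e| ^ p
      ≤ ∑ e ∈ S, (ε / (4 * (m + 1)) * (|grad G (g n) e| ^ p + |grad G (g k) e| ^ p) +
          C * ((|grad G (g n) e| ^ p + |grad G (g k) e| ^ p) / 2 - |grad G w e| ^ p)) :=
        Finset.sum_le_sum fun e _ => by
          rw [grad_sub, hgw]
          exact hineq _ _
    _ ≤ ∑' e, (ε / (4 * (m + 1)) * (|grad G (g n) e| ^ p + |grad G (g k) e| ^ p) +
          C * ((|grad G (g n) e| ^ p + |grad G (g k) e| ^ p) / 2 - |grad G w e| ^ p)) := by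
        refine (hs1.add hs2).sum_le_tsum S fun e _ => ?_
        have h1 : (0 : ℝ) ≤ |grad G (g n) e| ^ p := Real.rpow_nonneg (abs_nonneg _) _
        have h2 : (0 : ℝ) ≤ |grad G (g k) e| ^ p := Real.rpow_nonneg (abs_nonneg _) _
        have h3 := abs_midpoint_rpow_le hp (grad G (g n) e) (grad G (g k) e)
        rw [← hgw] at h3
        have := mul_nonneg hC (sub_nonneg.2 h3)
        positivity
    _ = ε / (4 * (m + 1)) * (∑' e, |grad G (g n) e| ^ p + ∑' e, |grad G (g k) e| ^ p) +
          C * ((∑' e, |grad G (g n) e| ^ p + ∑' e, |grad G (g k) e| ^ p) / 2 -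
            ∑' e, |grad G w e| ^ p) := by
        rw [hs1.tsum_add hs2, tsum_mul_left, tsum_mul_left, (hs.div_const 2).tsum_sub hws,
          tsum_div_const, (hE n).summable.tsum_add (hE k).summable]
    _ ≤ ε / (4 * (m + 1)) * (2 * (m + 1)) + C * t := by
        have hn := hle n hn
        have hk := hle k hk
        refine add_le_add (mul_le_mul_of_nonneg_left ?_ (by positivity))
          (mul_le_mul_of_nonneg_left ?_ hC) <;> linarith
    _ ≤ ε := by
        have h2 : C * t ≤ C * (ε / (2 * (C + 1))) := mul_le_mul_of_nonneg_left hN.le hC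
        have h3 : C * (ε / (2 * (C + 1))) ≤ ε / 2 := by
          rw [mul_div_assoc', div_le_div_iff₀ (by positivity) (by positivity)]
          nlinarith
        have h4 : ε / (4 * (m + 1)) * (2 * (m + 1)) = ε / 2 := by
          field_simp
          norm_num
        linarith

variable [G.LocallyFinite]

/-- A minimizing sequence for the `p`-energy, among the functions which differ from `f` at finitely
many vertices only. -/
theorem exists_minimizing_seq (hp : 1 < p) {f : V → ℝ} {B : ℝ} (hf : EnergyLE G p f B) {M : ℝ}
    (hM0 : 0 ≤ M) (hM : ∀ x, |f x| ≤ M) :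
    ∃ (m : ℝ) (g : ℕ → V → ℝ), 0 ≤ m ∧ (∀ n, (f - g n).support.Finite) ∧ (∀ n x, |g n x| ≤ M) ∧
      (∀ n : ℕ, EnergyLE G p (g n) (m + 1 / (n + 1))) ∧
      ∀ k : V → ℝ, (f - k).support.Finite →
        (Summable fun e => |grad G k e| ^ p) ∧ m ≤ ∑' e, |grad G k e| ^ p := by
  let A : Set ℝ := {r | ∃ k : V → ℝ, (f - k).support.Finite ∧ ∑' e, |grad G k e| ^ p = r}
  have hA : A.Nonempty := ⟨_, f, by simp, rfl⟩
  have h0 : ∀ r ∈ A, 0 ≤ r := by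
    rintro _ ⟨k, -, rfl⟩
    exact tsum_nonneg fun _ => Real.rpow_nonneg (abs_nonneg _) _
  have hbdd : BddBelow A := ⟨0, h0⟩
  have hsum : ∀ k : V → ℝ, (f - k).support.Finite → Summable fun e => |grad G k e| ^ p := by
    intro k hk
    have := hf.sub hp (EnergyLE.of_finite_support (G := G) hp hk)
    rw [sub_sub_cancel] at this
    exact this.summable
  have hex : ∀ n : ℕ, ∃ k : V → ℝ, (f - k).support.Finite ∧
      ∑' e, |grad G k e| ^ p < sInf A + 1 / (n + 1) := by
    intro n
    obtain ⟨_, ⟨k, hk, rfl⟩, h⟩ := exists_lt_of_csInf_lt hA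
      (show sInf A < sInf A + 1 / ((n : ℝ) + 1) by
        have : (0 : ℝ) < 1 / ((n : ℝ) + 1) := by positivity
        linarith)
    exact ⟨k, hk, h⟩
  choose k hk hklt using hex
  refine ⟨sInf A, fun n x => max (-M) (min (k n x) M), le_csInf hA h0, fun n => ?_, fun n x => ?_,
    fun n => ?_, fun k hk => ⟨hsum k hk, csInf_le hbdd ⟨k, hk, rfl⟩⟩⟩
  -- As `|f| ≤ M`, truncation changes nothing at vertices where `k n` agrees with `f`.
  · refine (hk n).subset fun x hx => ?_
    contrapose! hx
    simp only [Function.mem_support, Pi.sub_apply, not_not, sub_eq_zero] at hx ⊢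
    have := abs_le.1 (hM x)
    rw [← hx, min_eq_left this.2, max_eq_right this.1]
  · exact abs_le.2 ⟨le_max_left _ _, max_le (by linarith) (min_le_right _ _)⟩
  · have h1 := (energyLE_tsum (hsum (k n) (hk n))).mono hp (g := fun x => max (-M) (min (k n x) M))
      (abs_grad_le G fun x y => abs_clamp_sub_clamp_le _ _ _ _)
    exact fun S => (h1 S).trans (hklt n).le

/-- The Euler–Lagrange equation. -/
theorem isPHarmonic_of_minimizing (hp : 1 < p) {f h : V → ℝ} {m : ℝ} {g : ℕ → V → ℝ}
    (hfin : ∀ n, (f - g n).support.Finite) (hE : ∀ n : ℕ, EnergyLE G p (g n) (m + 1 / (n + 1)))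
    (hmin : ∀ k : V → ℝ, (f - k).support.Finite →
        (Summable fun e => |grad G k e| ^ p) ∧ m ≤ ∑' e, |grad G k e| ^ p)
    {φ : ℕ → ℕ} (hφ : StrictMono φ) (hlim : ∀ x, Tendsto (fun n => g (φ n) x) atTop (𝓝 (h x))) :
    IsPHarmonic G p h := by
  classical
  intro z
  let v : V → ℝ := Pi.single z 1
  have hvsupp : v.support = {z} := Pi.support_single_of_ne (by norm_num)
  have hv : v.support.Finite := by rw [hvsupp]; exact Set.finite_singleton z
  let S : Finset (V × V) := (finite_support_grad G hv).toFinset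
  have hS : ∀ e ∉ S, grad G v e = 0 := fun e he => by simpa [S] using he
  let Φ : ℝ → ℝ := fun t => ∑ e ∈ S, |grad G h e + t * grad G v e| ^ p
  -- `h` itself need not be a competitor. The inequality is obtained for `g n`, up to an error `1 /
  -- (n + 1)`, and passed to the limit over the finite set `S`.
  have hΦ : ∀ t, Φ 0 ≤ Φ t := by
    intro t
    have hn : ∀ n, 0 ≤ ∑ e ∈ S, (|grad G (g n + t • v) e| ^ p - |grad G (g n) e| ^ p) +
        1 / ((n : ℝ) + 1) := by
      intro n
      obtain ⟨hs, hm⟩ := hmin (g n + t • v) (by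
        refine ((hfin n).union hv).subset fun x hx => ?_
        contrapose! hx
        simp only [Set.mem_union, Function.mem_support, Pi.sub_apply, not_or, not_not] at hx ⊢
        simp only [Pi.add_apply, Pi.smul_apply, smul_eq_mul, hx.2]
        linarith [hx.1])
      have h1 := hs.tsum_sub (hE n).summable
      rw [tsum_eq_sum (s := S) (fun e he => by rw [grad_add, grad_smul, hS e he]; simp)] at h1
      rw [h1]
      linarith [(hE n).tsum_le]
    have hc := continuous_abs_rpow hp
    have hpt : ∀ x, Tendsto (fun n => (g (φ n) + t • v) x) atTop (𝓝 ((h + t • v) x)) :=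
      fun x => (hlim x).add tendsto_const_nhds
    have hT : Tendsto (fun n => ∑ e ∈ S, (|grad G (g (φ n) + t • v) e| ^ p -
        |grad G (g (φ n)) e| ^ p) + 1 / ((φ n : ℝ) + 1)) atTop
        (𝓝 (∑ e ∈ S, (|grad G (h + t • v) e| ^ p - |grad G h e| ^ p) + 0)) :=
      (tendsto_finsetSum S fun e _ =>
        ((hc.tendsto _).comp (tendsto_grad G hpt e)).sub
          ((hc.tendsto _).comp (tendsto_grad G hlim e))).add
        (tendsto_one_div_add_atTop_nhds_zero_nat.comp hφ.tendsto_atTop)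
    have h0 := ge_of_tendsto' hT fun n => hn (φ n)
    rw [add_zero, Finset.sum_sub_distrib] at h0
    simp only [grad_add, grad_smul] at h0
    simp only [Φ, zero_mul, add_zero]
    linarith
  have hderiv : HasDerivAt Φ (∑ e ∈ S, p * |grad G h e| ^ (p - 2) * grad G h e * grad G v e) 0 := by
    refine HasDerivAt.fun_sum fun e _ => ?_
    have h1 : HasDerivAt (fun t : ℝ => grad G h e + t * grad G v e) (grad G v e) 0 := by
      simpa using ((hasDerivAt_id (0 : ℝ)).mul_const (grad G v e)).const_add (grad G h e)
    have h2 := hasDerivAt_abs_rpow (grad G h e + 0 * grad G v e) hp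
    have h3 := h2.comp (0 : ℝ) h1
    simp only [zero_mul, add_zero] at h3
    exact h3
  have hzero := IsLocalMin.hasDerivAt_eq_zero (f := Φ) (a := 0) (Filter.Eventually.of_forall hΦ)
    hderiv
  -- Since `v` is the indicator of `z`, Green's formula identifies the derivative of `Φ` at `0` with
  -- `-2 p Δ_p h(z)`.
  have hgreen := hasSum_signedPow_grad_mul_grad (p := p) G h hv
  have hgreen' : HasSum (fun e => signedPow p (grad G h e) * grad G v e)
      (∑ e ∈ S, signedPow p (grad G h e) * grad G v e) :=
    hasSum_sum_of_ne_finset_zero fun e he => by rw [hS e he, mul_zero]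
  have heq := hgreen.unique hgreen'
  have h1 : ∑ e ∈ S, p * |grad G h e| ^ (p - 2) * grad G h e * grad G v e =
      p * ∑ e ∈ S, signedPow p (grad G h e) * grad G v e := by
    rw [Finset.mul_sum]
    refine Finset.sum_congr rfl fun e _ => ?_
    rw [signedPow]
    ring
  have hfs : hv.toFinset = {z} := by
    ext x
    simp [hvsupp]
  rw [h1, ← heq, hfs, Finset.sum_singleton] at hzero
  have hvz : v z = 1 := Pi.single_eq_same z 1
  rw [hvz, one_mul] at hzero
  rcases mul_eq_zero.1 hzero with h | h <;> linarith

/-- The Royden decomposition of a bounded Dirichlet finite function. -/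
theorem exists_royden_decomposition [Countable V] (hp : 1 < p) (o : V) {f : V → ℝ}
    (hf : dirichletSum G p f < ∞) {M : ℝ} (hM : ∀ x, |f x| ≤ M) :
    ∃ h : V → ℝ, IsPHarmonic G p h ∧ dirichletSum G p h < ∞ ∧ (∀ x, |h x| ≤ M) ∧
      InClosureFinSupp G p o (f - h) := by
  obtain ⟨B, hB⟩ := (dirichletSum_lt_top_iff G hp f).1 hf
  obtain ⟨m, g, hm, hfin, hgM, hE, hmin⟩ :=
    exists_minimizing_seq G hp hB ((abs_nonneg _).trans (hM o)) hM
  obtain ⟨h, hh, φ, hφ, hlim⟩ :=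
    -- Countability of `V` makes the compact product sequentially compact.
    (isCompact_univ_pi fun _ : V => isCompact_Icc (a := -M) (b := M)).tendsto_subseq
      (x := g) fun n x _ => abs_le.1 (hgM n x)
  have hlim' : ∀ x, Tendsto (fun n => g (φ n) x) atTop (𝓝 (h x)) := tendsto_pi_nhds.1 hlim
  have hhE : EnergyLE G p h (m + 1) := EnergyLE.of_tendsto hp hlim' (Eventually.of_forall
    fun n S => (hE (φ n) S).trans (by
      have : (1 : ℝ) / ((φ n : ℝ) + 1) ≤ 1 := by
        rw [div_le_one (by positivity)]
        linarith [show (0 : ℝ) ≤ φ n from (φ n).cast_nonneg]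
      linarith))
  have hconv : Tendsto (fun n => dirichletSum G p (g (φ n) - h)) atTop (𝓝 0) := by
    rw [ENNReal.tendsto_nhds_zero]
    intro ε hε
    obtain ⟨r, hr0, hr⟩ := ENNReal.lt_iff_exists_real_btwn.1 hε
    have hr0' : 0 < r := ENNReal.ofReal_pos.1 hr.1
    obtain ⟨N, hN⟩ := energyLE_sub_of_minimizing G hp hm hfin hE hmin hr0'
    filter_upwards [eventually_ge_atTop N] with n hn
    -- Fatou in the second index of the Cauchy estimate.
    have h1 : EnergyLE G p (g (φ n) - h) r :=
      EnergyLE.of_tendsto (l := atTop) (g := fun k => g (φ n) - g (φ k)) hp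
        (fun x => tendsto_const_nhds.sub (hlim' x))
        ((eventually_ge_atTop N).mono fun k hk =>
          hN _ (hn.trans (hφ.id_le n)) _ (hk.trans (hφ.id_le k)))
    exact (dirichletSum_le_ofReal G hp h1).trans hr.2.le
  refine ⟨h, isPHarmonic_of_minimizing G hp hfin hE hmin hφ hlim',
    (dirichletSum_lt_top_iff G hp h).2 ⟨_, hhE⟩, fun x => abs_le.2 (hh x trivial),
    (dirichletSum_lt_top_iff G hp _).2 ⟨_, hB.sub hp hhE⟩, fun ε hε => ?_⟩
  have hnorm : Tendsto (fun n => dpNorm G p o (g (φ n) - h)) atTop (𝓝 0) := by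
    have h1 : Tendsto (fun n => ENNReal.ofReal (|(g (φ n) - h) o| ^ p)) atTop (𝓝 0) := by
      have h2 : Tendsto (fun n => (g (φ n) - h) o) atTop (𝓝 0) := by
        simpa using (hlim' o).sub_const (h o)
      have h3 := ENNReal.tendsto_ofReal (((continuous_abs_rpow hp).tendsto _).comp h2)
      simpa [Real.zero_rpow (show p ≠ 0 by linarith)] using h3
    have h4 := (ENNReal.continuous_rpow_const (y := 1 / p)).tendsto _ |>.comp (hconv.add h1)
    have hp' : 0 < p⁻¹ := by positivity
    simpa [ENNReal.zero_rpow_of_pos hp', Function.comp_def, dpNorm] using h4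
  obtain ⟨n, hn⟩ := (hnorm.eventually_lt_const hε).exists
  refine ⟨f - g (φ n), hfin _, ?_⟩
  rwa [show f - h - (f - g (φ n)) = g (φ n) - h by abel]

end

section

/-! ### Limits of finitely supported functions with bounded energy -/

variable {V : Type*} (G : SimpleGraph V) (p : ℝ)

/-- `f` is the pointwise limit of a sequence of finitely supported functions of bounded energy. -/
def IsFinSuppLimit (f : V → ℝ) : Prop :=
  ∃ (g : ℕ → V → ℝ) (B : ℝ), (∀ n, (g n).support.Finite) ∧ (∀ n, EnergyLE G p (g n) B) ∧
    ∀ x, Tendsto (fun n => g n x) atTop (𝓝 (f x))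

variable {G p}

theorem isFinSuppLimit_zero (hp : 1 < p) : IsFinSuppLimit G p 0 := by
  refine ⟨fun _ => 0, 0, by simp, fun _ S => ?_, fun x => tendsto_const_nhds⟩
  have : grad G (0 : V → ℝ) = 0 := by
    funext e
    simp [grad]
  simp [this, Real.zero_rpow (show p ≠ 0 by linarith)]

theorem IsFinSuppLimit.abs (hp : 1 < p) {f : V → ℝ} (hf : IsFinSuppLimit G p f) :
    IsFinSuppLimit G p fun x => |f x| := by
  obtain ⟨g, B, hg, hB, hlim⟩ := hf
  exact ⟨fun n x => |g n x|, B, fun n => (hg n).subset fun x hx => by simpa using hx,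
    fun n => (hB n).mono hp (abs_grad_le G fun x y => abs_abs_sub_abs_le_abs_sub _ _),
    fun x => (hlim x).abs⟩

theorem IsFinSuppLimit.add (hp : 1 < p) {f k : V → ℝ} (hf : IsFinSuppLimit G p f)
    (hk : IsFinSuppLimit G p k) : IsFinSuppLimit G p (f + k) := by
  obtain ⟨g, B, hg, hB, hlim⟩ := hf
  obtain ⟨g', B', hg', hB', hlim'⟩ := hk
  exact ⟨fun n => g n + g' n, _, fun n => ((hg n).union (hg' n)).subset (Function.support_add _ _),
    fun n => (hB n).add hp (hB' n), fun x => (hlim x).add (hlim' x)⟩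

theorem IsFinSuppLimit.smul (c : ℝ) {f : V → ℝ} (hf : IsFinSuppLimit G p f) :
    IsFinSuppLimit G p (c • f) := by
  obtain ⟨g, B, hg, hB, hlim⟩ := hf
  exact ⟨fun n => c • g n, _, fun n => (hg n).subset (Function.support_const_smul_subset _ _),
    fun n => (hB n).smul c, fun x => (hlim x).const_mul c⟩

theorem IsFinSuppLimit.sum (hp : 1 < p) {ι : Type*} (s : Finset ι) {f : ι → V → ℝ}
    (hf : ∀ i ∈ s, IsFinSuppLimit G p (f i)) : IsFinSuppLimit G p (∑ i ∈ s, f i) := by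
  classical
  induction s using Finset.induction_on with
  | empty => simpa using isFinSuppLimit_zero hp
  | insert a s ha ih =>
    rw [Finset.sum_insert ha]
    exact (hf a (Finset.mem_insert_self a s)).add hp
      (ih fun i hi => hf i (Finset.mem_insert_of_mem hi))

theorem abs_min_sub_min_le_add (a b c d : ℝ) : |min a b - min c d| ≤ |a - c| + |b - d| :=
  (abs_min_sub_min_le_max a b c d).trans
    (max_le_add_of_nonneg (abs_nonneg _) (abs_nonneg _))

/-- A nonnegative function of finite energy which is dominated by a limit of finitely supported
functions is such a limit itself. -/
theorem IsFinSuppLimit.of_le (hp : 1 < p) {f w : V → ℝ} {A : ℝ} (hf : IsFinSuppLimit G p f)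
    (hw : EnergyLE G p w A) (h0 : ∀ x, 0 ≤ w x) (hle : ∀ x, w x ≤ f x) :
    IsFinSuppLimit G p w := by
  obtain ⟨g, B, hg, hB, hlim⟩ := hf.abs hp
  -- Because `w ≥ 0`, the minimum vanishes wherever `g n` does, and it converges to `min w |f| = w`.
  refine ⟨fun n x => min (w x) |g n x|, _, fun n => (hg n).subset fun x hx => ?_,
    fun n => hw.of_le_add hp ((hB n)) fun e => ?_, fun x => ?_⟩
  · contrapose! hx
    simp only [Function.mem_support, not_not] at hx ⊢
    simp [hx, h0 x]
  · unfold grad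
    split_ifs
    · exact (abs_min_sub_min_le_add _ _ _ _).trans
        (add_le_add le_rfl (abs_abs_sub_abs_le_abs_sub _ _))
    · simp
  · have h1 : min (w x) |(|f x|)| = w x := by
      rw [abs_abs]
      exact min_eq_left ((hle x).trans (le_abs_self _))
    have h2 := (tendsto_const_nhds (x := w x)).min (hlim x).abs
    rwa [h1] at h2

/-- Each edge increment is bounded by the `p`-th root of the energy, so convergence spreads from `o`
along walks. -/
theorem tendsto_of_tendsto_energy (hconn : G.Connected) (hp : 1 < p) {g : ℕ → V → ℝ} {B : ℕ → ℝ}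
    (hE : ∀ n, EnergyLE G p (g n) (B n)) (hB : Tendsto B atTop (𝓝 0)) {o : V}
    (ho : Tendsto (fun n => g n o) atTop (𝓝 0)) (x : V) :
    Tendsto (fun n => g n x) atTop (𝓝 0) := by
  have hp0 : 0 < p := by linarith
  have hadj : ∀ {x y}, G.Adj x y → Tendsto (fun n => g n x) atTop (𝓝 0) →
      Tendsto (fun n => g n y) atTop (𝓝 0) := by
    intro x y hxy hx
    have h1 : Tendsto (fun n => |g n y - g n x|) atTop (𝓝 0) := by
      have h2 : Tendsto (fun n => B n ^ (1 / p)) atTop (𝓝 0) := by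
        have := hB.rpow_const (p := 1 / p) (Or.inr (by positivity))
        rwa [Real.zero_rpow (by positivity)] at this
      refine squeeze_zero (fun _ => abs_nonneg _) (fun n => ?_) h2
      have h3 := hE n {(x, y)}
      rw [Finset.sum_singleton, grad_of_adj G hxy] at h3
      rw [← Real.rpow_rpow_inv (abs_nonneg (g n y - g n x)) hp0.ne', one_div]
      exact Real.rpow_le_rpow (Real.rpow_nonneg (abs_nonneg _) _) h3 (by positivity)
    simpa using ((tendsto_zero_iff_abs_tendsto_zero _).2 h1).add hx
  obtain ⟨W⟩ := hconn.preconnected o x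
  induction W with
  | nil => exact ho
  | cons h _ ih => exact ih (hadj h ho)

variable [G.LocallyFinite]

/-- Bounded energy with pointwise convergence is weaker than norm approximation, but it passes
easily to absolute values and minima and still suffices for testing `p`-harmonic functions. -/
theorem InClosureFinSupp.isFinSuppLimit (hconn : G.Connected) (hp : 1 < p) {o : V} {f : V → ℝ}
    (hf : InClosureFinSupp G p o f) : IsFinSuppLimit G p f := by
  have hp0 : 0 < p := by linarith
  have hex : ∀ n : ℕ, ∃ g : V → ℝ, g.support.Finite ∧
      dpNorm G p o (f - g) < ENNReal.ofReal (1 / ((n : ℝ) + 1)) := fun n =>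
    hf.2 _ (ENNReal.ofReal_pos.2 (by positivity))
  choose g hg hlt using hex
  have hle : ∀ n : ℕ, dirichletSum G p (f - g n) + ENNReal.ofReal (|(f - g n) o| ^ p) ≤
      ENNReal.ofReal ((1 / ((n : ℝ) + 1)) ^ p) := by
    intro n
    have h1 := ENNReal.rpow_le_rpow (hlt n).le hp0.le
    rwa [dpNorm, ← ENNReal.rpow_mul, one_div_mul_cancel hp0.ne', ENNReal.rpow_one,
      ENNReal.ofReal_rpow_of_nonneg (by positivity) hp0.le] at h1
  have hnn : ∀ n : ℕ, (0 : ℝ) ≤ (1 / ((n : ℝ) + 1)) ^ p := fun n => by positivity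
  have hE : ∀ n : ℕ, EnergyLE G p (f - g n) ((1 / ((n : ℝ) + 1)) ^ p) := by
    intro n S
    have h1 : dirichletSum G p (f - g n) ≤ ENNReal.ofReal ((1 / ((n : ℝ) + 1)) ^ p) :=
      le_self_add.trans (hle n)
    exact (energyLE_toReal G hp (h1.trans_lt ENNReal.ofReal_lt_top) S).trans
      (ENNReal.toReal_le_of_le_ofReal (hnn n) h1)
  have ho : Tendsto (fun n => (f - g n) o) atTop (𝓝 0) := by
    refine (tendsto_zero_iff_abs_tendsto_zero _).2 (squeeze_zero (fun _ => abs_nonneg _)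
      (fun n => ?_) (tendsto_one_div_add_atTop_nhds_zero_nat (𝕜 := ℝ)))
    have h1 := (ENNReal.ofReal_le_ofReal_iff (hnn n)).1 (le_add_self.trans (hle n))
    exact (Real.rpow_le_rpow_iff (abs_nonneg _) (by positivity) hp0).1 h1
  have hB : Tendsto (fun n : ℕ => (1 / ((n : ℝ) + 1)) ^ p) atTop (𝓝 0) := by
    have := (tendsto_one_div_add_atTop_nhds_zero_nat (𝕜 := ℝ)).rpow_const (p := p)
      (Or.inr hp0.le)
    rwa [Real.zero_rpow hp0.ne'] at this
  obtain ⟨A, hA⟩ := (dirichletSum_lt_top_iff G hp f).1 hf.1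
  refine ⟨g, 2 ^ p * A + 2 ^ p * 1, hg, fun n => ?_, fun x => ?_⟩
  · have h1 : EnergyLE G p (f - g n) 1 := fun S => (hE n S).trans
      (Real.rpow_le_one (by positivity) (by
        rw [div_le_one (by positivity)]
        linarith [show (0 : ℝ) ≤ n from n.cast_nonneg]) hp0.le)
    have h2 := hA.sub hp h1
    rwa [sub_sub_cancel] at h2
  · have h1 := (tendsto_of_tendsto_energy hconn hp hE hB ho x).const_sub (f x)
    simpa using h1

/-- Two `p`-harmonic functions of finite energy, tested with a limit of finitely supported
functions. -/
theorem mul_grad_eq_zero_of_nonneg (hp : 1 < p) {h₁ h₂ w : V → ℝ} {B₁ B₂ : ℝ}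
    (hh₁ : IsPHarmonic G p h₁) (hh₂ : IsPHarmonic G p h₂) (hB₁ : EnergyLE G p h₁ B₁)
    (hB₂ : EnergyLE G p h₂ B₂) (hw : IsFinSuppLimit G p w)
    (hnn : ∀ e, 0 ≤ (signedPow p (grad G h₁ e) - signedPow p (grad G h₂ e)) * grad G w e)
    (e : V × V) :
    (signedPow p (grad G h₁ e) - signedPow p (grad G h₂ e)) * grad G w e = 0 := by
  classical
  have hpq : p.HolderConjugate p.conjExponent := Real.HolderConjugate.conjExponent hp
  set q := p.conjExponent
  set a : V × V → ℝ := fun e => signedPow p (grad G h₁ e) - signedPow p (grad G h₂ e)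
  have hq : 1 < q := hpq.symm.lt
  have hψ : ∀ t : ℝ, |signedPow p t| ^ q = |t| ^ p := by
    intro t
    rw [abs_signedPow hp, ← Real.rpow_mul (abs_nonneg _), hpq.sub_one_mul_conj]
  -- The signed power carries `ℓ^p` gradients to `ℓ^q`, the dual exponent.
  have ha : Summable fun e => |a e| ^ q := by
    refine Summable.of_nonneg_of_le (fun _ => Real.rpow_nonneg (abs_nonneg _) _) (fun e => ?_)
      ((hB₁.summable.mul_left (2 ^ q)).add (hB₂.summable.mul_left (2 ^ q)))
    have := rpow_le_of_abs_le hq zero_le_one zero_le_one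
      (show |a e| ≤ 1 * |signedPow p (grad G h₁ e)| + 1 * |signedPow p (grad G h₂ e)| by
        rw [one_mul, one_mul]; exact abs_sub _ _)
    simpa only [hψ, mul_one] using this
  obtain ⟨g, B, hg, hB, hlim⟩ := hw
  have hzero : ∀ n, HasSum (fun e => a e * grad G (g n) e) 0 := by
    intro n
    have h1 := hasSum_signedPow_grad_mul_grad (p := p) G h₁ (hg n)
    have h2 := hasSum_signedPow_grad_mul_grad (p := p) G h₂ (hg n)
    simp only [hh₁ _, hh₂ _, mul_zero, Finset.sum_const_zero] at h1 h2
    simpa [a, sub_mul] using h1.sub h2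
  refine le_antisymm (le_of_forall_pos_le_add fun ρ hρ => ?_) (hnn e)
  have hB0 : 0 ≤ B := (hB 0).nonneg
  have hBp : 0 ≤ B ^ (1 / p) := Real.rpow_nonneg hB0 _
  -- Chosen so that `B ^ (1 / p) * η ^ (1 / q) ≤ ρ` in Hölder's inequality.
  set η : ℝ := (ρ / (B ^ (1 / p) + 1)) ^ q
  have hη : 0 < η := Real.rpow_pos_of_pos (by positivity) _
  have hηq : η ^ (1 / q) = ρ / (B ^ (1 / p) + 1) := by
    rw [one_div, Real.rpow_rpow_inv (by positivity) (by linarith)]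
  obtain ⟨F, hF⟩ := summable_iff_vanishing_norm.1 ha η hη
  -- The full sum is `0`, so this finite part is minus a tail. Hölder bounds the tail uniformly in
  -- `n`: there `a` is small in `ℓ^q` and the gradients are bounded in `ℓ^p`.
  have hn : ∀ n, ∑ e ∈ insert e F, a e * grad G (g n) e ≤ ρ := by
    intro n
    let S : Finset (V × V) := (finite_support_grad G (hg n)).toFinset
    have h1 : ∑ e ∈ insert e F ∪ S, a e * grad G (g n) e = 0 := by
      refine (hasSum_sum_of_ne_finset_zero fun e he => ?_).unique (hzero n)
      have : grad G (g n) e = 0 := by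
        by_contra h
        exact he (Finset.mem_union_right _ (by simpa [S] using h))
      rw [this, mul_zero]
    rw [← Finset.union_sdiff_self_eq_union, Finset.sum_union Finset.disjoint_sdiff] at h1
    set T := S \ insert e F
    have hT : Disjoint T F :=
      Finset.disjoint_of_subset_right (Finset.subset_insert e F) Finset.sdiff_disjoint
    have h2 := Real.inner_le_Lp_mul_Lq T (grad G (g n)) (fun e => -a e) hpq
    simp only [abs_neg] at h2
    have h3 : ∑ e ∈ T, |a e| ^ q ≤ η := (le_abs_self _).trans (hF T hT).le
    have h4 : (∑ e ∈ T, |grad G (g n) e| ^ p) ^ (1 / p) ≤ B ^ (1 / p) :=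
      Real.rpow_le_rpow (Finset.sum_nonneg fun _ _ => Real.rpow_nonneg (abs_nonneg _) _) (hB n T)
        (by positivity)
    have h5 : (∑ e ∈ T, |a e| ^ q) ^ (1 / q) ≤ η ^ (1 / q) :=
      Real.rpow_le_rpow (Finset.sum_nonneg fun _ _ => Real.rpow_nonneg (abs_nonneg _) _) h3
        (by positivity)
    have h6 : ∑ e ∈ T, grad G (g n) e * -a e = -∑ e ∈ T, a e * grad G (g n) e := by
      rw [← Finset.sum_neg_distrib]
      exact Finset.sum_congr rfl fun e _ => by ring
    have h7 : B ^ (1 / p) * η ^ (1 / q) ≤ ρ := by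
      rw [hηq, mul_div_assoc', div_le_iff₀ (by positivity)]
      nlinarith
    have h8 := mul_le_mul h4 h5 (Real.rpow_nonneg (Finset.sum_nonneg fun _ _ =>
      Real.rpow_nonneg (abs_nonneg _) _) _) hBp
    linarith
  have h1 : ∑ e ∈ insert e F, a e * grad G w e ≤ ρ :=
    le_of_tendsto' (tendsto_finsetSum _ fun e _ => (tendsto_grad G hlim e).const_mul (a e)) hn
  have h2 := Finset.single_le_sum (f := fun e => a e * grad G w e) (fun e _ => hnn e)
    (Finset.mem_insert_self e F)
  linarith

/-- If the positive part of the difference of two `p`-harmonic functions (minus a constant) is a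
limit of finitely supported functions, then it is constant. -/
theorem posPart_sub_const (hconn : G.Connected) (hp : 1 < p) {h₁ h₂ : V → ℝ} {B₁ B₂ c : ℝ}
    (hh₁ : IsPHarmonic G p h₁) (hh₂ : IsPHarmonic G p h₂) (hB₁ : EnergyLE G p h₁ B₁)
    (hB₂ : EnergyLE G p h₂ B₂) (hw : IsFinSuppLimit G p fun x => max (h₁ x - h₂ x - c) 0)
    (x y : V) : max (h₁ x - h₂ x - c) 0 = max (h₁ y - h₂ y - c) 0 := by
  have hmono := signedPow_strictMono hp
  -- Both `signedPow` and `s ↦ max (s - c) 0` are monotone, so along an edge the two factors have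
  -- the sign of the increment of `h₁ - h₂`.
  have hnn : ∀ e, 0 ≤ (signedPow p (grad G h₁ e) - signedPow p (grad G h₂ e)) *
      grad G (fun x => max (h₁ x - h₂ x - c) 0) e := by
    rintro ⟨x, y⟩
    by_cases hadj : G.Adj x y
    · simp only [grad_of_adj G hadj]
      rcases le_total (h₁ x - h₂ x) (h₁ y - h₂ y) with h | h
      · exact mul_nonneg (sub_nonneg.2 (hmono.monotone (by linarith)))
          (sub_nonneg.2 (max_le_max_right 0 (by linarith)))
      · exact mul_nonneg_of_nonpos_of_nonpos (sub_nonpos.2 (hmono.monotone (by linarith)))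
          (sub_nonpos.2 (max_le_max_right 0 (by linarith)))
    · have : grad G (fun x => max (h₁ x - h₂ x - c) 0) (x, y) = 0 := if_neg hadj
      rw [this, mul_zero]
  have hstep : ∀ {x y}, G.Adj x y → max (h₁ x - h₂ x - c) 0 = max (h₁ y - h₂ y - c) 0 := by
    intro x y hadj
    have h := mul_grad_eq_zero_of_nonneg hp hh₁ hh₂ hB₁ hB₂ hw hnn (x, y)
    simp only [grad_of_adj G hadj] at h
    rcases mul_eq_zero.1 h with h | h
    · have := hmono.injective (sub_eq_zero.1 h)
      rw [show h₁ x - h₂ x = h₁ y - h₂ y by linarith]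
    · exact (sub_eq_zero.1 h).symm
  obtain ⟨W⟩ := hconn.preconnected x y
  induction W with
  | nil => rfl
  | cons h _ ih => exact (hstep h).trans ih

end

section

/-! ### The spectrum of `BD_p(G)` -/

variable {V : Type*} {G : SimpleGraph V} [G.LocallyFinite] {p : ℝ} {hp : 1 < p}

theorem continuous_gelfand (f : BD G hp) : Continuous (gelfand G hp f) :=
  (continuous_apply f).comp continuous_induced_dom

theorem gelfand_sub (f g : BD G hp) (τ : Sp G hp) :
    gelfand G hp (f - g) τ = gelfand G hp f τ - gelfand G hp g τ :=
  map_sub τ.1 f g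

theorem gelfand_one (τ : Sp G hp) : gelfand G hp 1 τ = 1 := by
  have h1 : gelfand G hp 1 τ * gelfand G hp 1 τ = gelfand G hp 1 τ := by
    unfold gelfand
    rw [← map_mul, one_mul]
  rcases IsIdempotentElem.iff_eq_zero_or_one.1 h1 with h | h
  · refine absurd (NonUnitalAlgHom.ext fun f => ?_) τ.2
    have h2 : τ.1 (1 * f) = τ.1 1 * τ.1 f := map_mul _ _ _
    rw [one_mul] at h2
    rw [h2, show τ.1 1 = 0 from h, zero_mul]
    rfl
  · exact h

theorem gelfand_smul_one (c : ℝ) (τ : Sp G hp) : gelfand G hp (c • 1) τ = c := by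
  have h : τ.1 (c • 1) = c • τ.1 1 := map_smul _ _ _
  unfold gelfand
  rw [h, show τ.1 1 = 1 from gelfand_one τ, Complex.real_smul, mul_one]

/-- Inversion is Lipschitz on `[c, ∞)`, so the reciprocal stays bounded and of finite energy. -/
theorem exists_mul_eq_one_of_le {f : BD G hp} {c : ℝ} (hc : 0 < c)
    (hf : ∀ x, c ≤ (f : V → ℝ) x) : ∃ k : BD G hp, k * f = 1 := by
  have hpos : ∀ x, 0 < (f : V → ℝ) x := fun x => hc.trans_le (hf x)
  refine ⟨⟨fun x => ((f : V → ℝ) x)⁻¹, ?_, c⁻¹, fun x => ?_⟩, ?_⟩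
  · refine dirichletSum_lt_top_of_le G hp (a := c⁻¹ * c⁻¹) (b := 0) (by positivity) le_rfl
      (fun x y => ?_) f.2.1 f.2.1
    rw [zero_mul, add_zero, inv_sub_inv (hpos y).ne' (hpos x).ne', abs_div, abs_sub_comm,
      abs_of_pos (mul_pos (hpos y) (hpos x)), div_eq_inv_mul, mul_inv]
    refine mul_le_mul_of_nonneg_right ?_ (abs_nonneg _)
    exact mul_le_mul (inv_anti₀ hc (hf y)) (inv_anti₀ hc (hf x)) (inv_nonneg.2 (hpos x).le)
      (by positivity)
  · rw [abs_of_pos (inv_pos.2 (hpos x))]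
    exact inv_anti₀ hc (hf x)
  · ext x
    exact inv_mul_cancel₀ (hpos x).ne'

/-- Otherwise `(f - Re z)² + (Im z)²`, with `z = τ(f)`, would be bounded below and hence invertible
in `BD_p(G)`, although `τ` annihilates it. Reality and boundedness of characters follow, with no
continuity assumed. -/
theorem exists_sq_add_sq_lt (τ : Sp G hp) (f : BD G hp) {c : ℝ} (hc : 0 < c) :
    ∃ x, ((f : V → ℝ) x - (gelfand G hp f τ).re) ^ 2 + (gelfand G hp f τ).im ^ 2 < c := by
  by_contra! h
  set z := gelfand G hp f τ with hz
  let F : BD G hp := (f - z.re • 1) * (f - z.re • 1) + (z.im ^ 2) • 1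
  obtain ⟨k, hk⟩ := exists_mul_eq_one_of_le (f := F) hc fun x => by
    have h1 : (F : V → ℝ) x = ((f : V → ℝ) x - z.re) ^ 2 + z.im ^ 2 := by
      simp [F]
      ring
    rw [h1]
    exact h x
  have hF : gelfand G hp F τ = 0 := by
    have h1 : ∀ c : ℝ, τ.1 (c • 1) = c := fun c => gelfand_smul_one c τ
    have h2 : gelfand G hp F τ = (z - z.re) * (z - z.re) + ((z.im ^ 2 : ℝ) : ℂ) := by
      change τ.1 F = _
      simp only [F, map_add, map_mul, map_sub, h1]
      rfl
    rw [h2]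
    have h3 : z - z.re = z.im * Complex.I := by
      rw [sub_eq_iff_eq_add', Complex.re_add_im]
    rw [h3]
    push_cast
    linear_combination (z.im : ℂ) ^ 2 * Complex.I_sq
  have h4 : gelfand G hp (k * F) τ = gelfand G hp k τ * gelfand G hp F τ := map_mul τ.1 k F
  rw [hk, gelfand_one, hF, mul_zero] at h4
  exact one_ne_zero h4

theorem gelfand_im (τ : Sp G hp) (f : BD G hp) : (gelfand G hp f τ).im = 0 := by
  by_contra h
  obtain ⟨x, hx⟩ := exists_sq_add_sq_lt τ f (show 0 < (gelfand G hp f τ).im ^ 2 by positivity)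
  nlinarith [sq_nonneg ((f : V → ℝ) x - (gelfand G hp f τ).re)]

theorem abs_gelfand_re_le (τ : Sp G hp) {f : BD G hp} {M : ℝ} (hM : ∀ x, |(f : V → ℝ) x| ≤ M) :
    |(gelfand G hp f τ).re| ≤ M := by
  by_contra! h
  obtain ⟨x, hx⟩ := exists_sq_add_sq_lt τ f
    (show 0 < (|(gelfand G hp f τ).re| - M) ^ 2 by
      have : |(gelfand G hp f τ).re| - M ≠ 0 := by linarith
      positivity)
  have h1 : (|(gelfand G hp f τ).re| - M) ^ 2 ≤ ((f : V → ℝ) x - (gelfand G hp f τ).re) ^ 2 := by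
    rw [sq_le_sq, abs_of_pos (by linarith)]
    have := abs_sub_abs_le_abs_sub (gelfand G hp f τ).re ((f : V → ℝ) x)
    rw [abs_sub_comm] at this
    linarith [hM x]
  nlinarith [sq_nonneg (gelfand G hp f τ).im]

theorem norm_gelfand_le (τ : Sp G hp) {f : BD G hp} {M : ℝ} (hM : ∀ x, |(f : V → ℝ) x| ≤ M) :
    ‖gelfand G hp f τ‖ ≤ M := by
  have h : gelfand G hp f τ = ((gelfand G hp f τ).re : ℂ) :=
    Complex.ext rfl (by rw [gelfand_im, Complex.ofReal_im])
  rw [h, Complex.norm_real]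
  exact abs_gelfand_re_le τ hM

/-- The normalization `φ 1 = 1` replaces `τ ≠ 0`, so that all conditions are closed under pointwise
convergence. -/
theorem range_gelfand : Set.range (fun (τ : Sp G hp) (f : BD G hp) => gelfand G hp f τ) =
    {φ : BD G hp → ℂ | (∀ f g, φ (f + g) = φ f + φ g) ∧ (∀ (c : ℝ) f, φ (c • f) = c • φ f) ∧
      (∀ f g, φ (f * g) = φ f * φ g) ∧ φ 1 = 1} := by
  ext φ
  constructor
  · rintro ⟨τ, rfl⟩
    exact ⟨map_add τ.1, map_smul τ.1, map_mul τ.1, gelfand_one τ⟩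
  · rintro ⟨hadd, hsmul, hmul, hone⟩
    refine ⟨⟨{ toFun := φ
               map_smul' := hsmul
               map_zero' := by simpa using hsmul 0 0
               map_add' := hadd
               map_mul' := hmul }, fun h => ?_⟩, rfl⟩
    have h1 : φ 1 = 0 := DFunLike.congr_fun h (1 : BD G hp)
    exact one_ne_zero (hone.symm.trans h1)

instance Sp.instCompactSpace : CompactSpace (Sp G hp) := by
  have hind : IsInducing (fun (τ : Sp G hp) (f : BD G hp) => gelfand G hp f τ) := ⟨rfl⟩
  refine ⟨hind.isCompact_iff.2 ?_⟩
  rw [Set.image_univ]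
  choose M hM using fun f : BD G hp => f.2.2
  refine (isCompact_univ_pi fun f => isCompact_closedBall (0 : ℂ) (M f)).of_isClosed_subset ?_ ?_
  · rw [range_gelfand]
    simp only [Set.ofPred_and, Set.ofPred_forall]
    refine IsClosed.inter ?_ (IsClosed.inter ?_ (IsClosed.inter ?_ ?_))
    · exact isClosed_iInter fun f => isClosed_iInter fun g =>
        isClosed_eq (continuous_apply _) ((continuous_apply f).add (continuous_apply g))
    · exact isClosed_iInter fun c => isClosed_iInter fun f =>
        isClosed_eq (continuous_apply _) ((continuous_apply f).const_smul c)
    · exact isClosed_iInter fun f => isClosed_iInter fun g =>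
        isClosed_eq (continuous_apply _) ((continuous_apply f).mul (continuous_apply g))
    · exact isClosed_eq (continuous_apply _) continuous_const
  · rintro _ ⟨τ, rfl⟩ f -
    rw [mem_closedBall_zero_iff]
    exact norm_gelfand_le τ (hM f)

/-! ### The `p`-harmonic boundary as a compact subset of the spectrum -/

theorem inClosureFinSupp_of_finite_support (hp : 1 < p) (o : V) {f : V → ℝ}
    (hf : f.support.Finite) : InClosureFinSupp G p o f := by
  have hp0 : 0 < p := by linarith
  refine ⟨(dirichletSum_lt_top_iff G hp f).2 ⟨_, EnergyLE.of_finite_support hp hf⟩,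
    fun ε hε => ⟨f, hf, ?_⟩⟩
  have h0 : dirichletSum G p (f - f) = 0 := by
    rw [sub_self]
    exact dirichletSum_const G hp 0
  rw [dpNorm, h0, sub_self, Pi.zero_apply, abs_zero, Real.zero_rpow hp0.ne', ENNReal.ofReal_zero,
    add_zero, ENNReal.zero_rpow_of_pos (by positivity)]
  exact hε

/-- A vertex character is excluded automatically: it takes the value `1` on the indicator of its
vertex. What remains is a closed condition. -/
theorem mem_pHarmonicBoundary_iff {o : V} {τ : Sp G hp} : τ ∈ pHarmonicBoundary G hp o ↔
    ∀ f : BD G hp, InClosureFinSupp G p o (f : V → ℝ) → gelfand G hp f τ = 0 := by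
  classical
  refine ⟨fun h => h.2, fun h => ⟨?_, h⟩⟩
  rintro ⟨x, rfl⟩
  have hfin : (Pi.single x (1 : ℝ) : V → ℝ).support.Finite :=
    (Set.finite_singleton x).subset Pi.support_single_subset
  have hcl := inClosureFinSupp_of_finite_support (G := G) hp x hfin
  have hb : IsBdd (Pi.single x (1 : ℝ) : V → ℝ) := ⟨1, fun y => by
    by_cases h : y = x
    · subst h
      simp
    · simp [h]⟩
  have h1 := h ⟨Pi.single x 1, hcl.1, hb⟩ (inClosureFinSupp_of_finite_support hp o hfin)
  have h2 : gelfand G hp ⟨Pi.single x 1, hcl.1, hb⟩ (vertexChar G hp x) =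
      (((Pi.single x 1 : V → ℝ) x : ℝ) : ℂ) := rfl
  rw [h2, Pi.single_eq_same] at h1
  simp at h1

theorem isClosed_pHarmonicBoundary (o : V) : IsClosed (pHarmonicBoundary G hp o) := by
  have h : pHarmonicBoundary G hp o = ⋂ (f : BD G hp) (_ : InClosureFinSupp G p o (f : V → ℝ)),
      {τ | gelfand G hp f τ = 0} := by
    ext τ
    simp [mem_pHarmonicBoundary_iff]
  rw [h]
  exact isClosed_iInter fun f => isClosed_iInter fun _ =>
    isClosed_eq (continuous_gelfand f) continuous_const

instance pHarmonicBoundary.instCompactSpace (o : V) :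
    CompactSpace (pHarmonicBoundary G hp o) :=
  isCompact_iff_compactSpace.1 (isClosed_pHarmonicBoundary o).isCompact

/-! ### The comparison principle -/

/-- The comparison principle: an inequality between `p`-harmonic functions which holds on the
`p`-harmonic boundary holds on the graph. -/
theorem sub_le_of_gelfand_sub_le (hconn : G.Connected) {o : V}
    (hne : (pHarmonicBoundary G hp o).Nonempty) {h₁ h₂ : BD G hp}
    (hh₁ : IsPHarmonic G p (h₁ : V → ℝ)) (hh₂ : IsPHarmonic G p (h₂ : V → ℝ)) {ε : ℝ}
    (hle : ∀ τ ∈ pHarmonicBoundary G hp o, (gelfand G hp (h₁ - h₂) τ).re ≤ ε) (x : V) :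
    (h₁ : V → ℝ) x - (h₂ : V → ℝ) x ≤ ε := by
  refine le_of_forall_pos_le_add fun η hη => ?_
  set c := ε + η
  let D : Sp G hp → ℝ := fun τ => (gelfand G hp (h₁ - h₂) τ).re
  have hD : Continuous D := Complex.continuous_re.comp (continuous_gelfand _)
  have hDx : ∀ y, D (vertexChar G hp y) = (h₁ : V → ℝ) y - (h₂ : V → ℝ) y := fun y => rfl
  -- This set misses the boundary as `c > ε`, so it is covered by the open sets where some `ĝ`, with
  -- `g` in the closure, is nonzero.
  have hK : IsCompact {τ | c ≤ D τ} := (isClosed_le continuous_const hD).isCompact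
  let I := {g : BD G hp // InClosureFinSupp G p o (g : V → ℝ)}
  obtain ⟨t, ht⟩ := hK.elim_finite_subcover (fun g : I => {τ | gelfand G hp g.1 τ ≠ 0})
    (fun g => isOpen_ne_fun (continuous_gelfand _) continuous_const) (by
      intro τ hτ
      by_contra h
      have h1 : τ ∈ pHarmonicBoundary G hp o := by
        refine mem_pHarmonicBoundary_iff.2 fun f hf => ?_
        by_contra h'
        exact h (Set.mem_iUnion.2 ⟨⟨f, hf⟩, h'⟩)
      have h2 : c ≤ D τ := hτ
      have := hle τ h1
      simp only [D, c] at h2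
      linarith)
  let Q : Sp G hp → ℝ := fun τ => ∑ g ∈ t, ‖gelfand G hp g.1 τ‖
  have hQ : Continuous Q := continuous_finsetSum _ fun g _ => (continuous_gelfand _).norm
  have hQpos : ∀ τ ∈ {τ | c ≤ D τ}, 0 < Q τ := by
    intro τ hτ
    obtain ⟨g, hg, hgτ⟩ := Set.mem_iUnion₂.1 (ht hτ)
    exact Finset.sum_pos' (fun _ _ => norm_nonneg _) ⟨g, hg, norm_pos_iff.2 hgτ⟩
  obtain ⟨d, hd, hdK⟩ : ∃ d > 0, ∀ τ ∈ {τ | c ≤ D τ}, d ≤ Q τ := by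
    rcases Set.eq_empty_or_nonempty {τ | c ≤ D τ} with h | h
    · exact ⟨1, one_pos, by simp [h]⟩
    · obtain ⟨z, hz, hmin⟩ := hK.exists_isMinOn h hQ.continuousOn
      exact ⟨Q z, hQpos z hz, fun w hw => hmin hw⟩
  have hQx : ∀ y, Q (vertexChar G hp y) = ∑ g ∈ t, |(g.1 : V → ℝ) y| := fun y =>
    Finset.sum_congr rfl fun g _ => Complex.norm_real _
  obtain ⟨M, hM⟩ := (h₁ - h₂).2.2
  have hM0 : 0 ≤ M := (abs_nonneg _).trans (hM x)
  -- Where `h₁ - h₂ ≥ c` the sum is at least `d`, so the factor makes `f` at least `M + |c| ≥ h₁ -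
  -- h₂ - c`.
  let f : V → ℝ := ((M + |c|) / d) • ∑ g ∈ t, fun y => |(g.1 : V → ℝ) y|
  have hfy : ∀ y, f y = (M + |c|) / d * ∑ g ∈ t, |(g.1 : V → ℝ) y| := fun y => by
    simp [f, Finset.sum_apply]
  have hf : IsFinSuppLimit G p f :=
    (IsFinSuppLimit.sum hp t fun g _ => (g.2.isFinSuppLimit hconn hp).abs hp).smul _
  obtain ⟨B₁, hB₁⟩ := (dirichletSum_lt_top_iff G hp _).1 h₁.2.1
  obtain ⟨B₂, hB₂⟩ := (dirichletSum_lt_top_iff G hp _).1 h₂.2.1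
  let w : V → ℝ := fun y => max ((h₁ : V → ℝ) y - (h₂ : V → ℝ) y - c) 0
  have hwE : EnergyLE G p w _ := (hB₁.sub hp hB₂).mono hp (abs_grad_le G fun y z => by
    refine (abs_max_sub_max_le_abs _ _ _).trans (le_of_eq ?_)
    simp only [Pi.sub_apply]
    congr 1
    ring)
  have hw : IsFinSuppLimit G p w := hf.of_le hp hwE (fun y => le_max_right _ _) fun y => by
    have hsum : 0 ≤ ∑ g ∈ t, |(g.1 : V → ℝ) y| := Finset.sum_nonneg fun _ _ => abs_nonneg _
    rw [hfy]
    refine max_le ?_ (by positivity)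
    rcases lt_or_ge ((h₁ : V → ℝ) y - (h₂ : V → ℝ) y) c with h | h
    · exact (sub_neg.2 h).le.trans (by positivity)
    · have h1 := hdK (vertexChar G hp y) (by simpa only [Set.mem_ofPred_eq, hDx] using h)
      rw [hQx] at h1
      have h2 : (h₁ : V → ℝ) y - (h₂ : V → ℝ) y ≤ M := (le_abs_self _).trans (hM y)
      have h3 := neg_abs_le c
      calc (h₁ : V → ℝ) y - (h₂ : V → ℝ) y - c ≤ M + |c| := by linarith
        _ = (M + |c|) / d * d := by field_simp
        _ ≤ _ := mul_le_mul_of_nonneg_left h1 (by positivity)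
  have hconst := posPart_sub_const hconn hp hh₁ hh₂ hB₁ hB₂ hw
  by_contra! hx
  obtain ⟨τ, hτ⟩ := hne
  -- A positive constant value of `w` makes `h₁ - h₂` the constant `s > ε`, which contradicts the
  -- bound at any boundary point.
  set s := (h₁ : V → ℝ) x - (h₂ : V → ℝ) x with hs
  have heq : h₁ - h₂ = s • (1 : BD G hp) := by
    ext y
    have h1 := hconst x y
    rw [max_eq_left (by linarith)] at h1
    have h2 : (h₁ : V → ℝ) y - (h₂ : V → ℝ) y = s := by
      rcases max_choice ((h₁ : V → ℝ) y - (h₂ : V → ℝ) y - c) 0 with h | h <;> rw [h] at h1 <;>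
        linarith
    simpa using h2
  have h1 := hle τ hτ
  rw [heq, gelfand_smul_one, Complex.ofReal_re] at h1
  linarith

theorem abs_sub_le_of_gelfand (hconn : G.Connected) {o : V}
    (hne : (pHarmonicBoundary G hp o).Nonempty) {h₁ h₂ : BD G hp}
    (hh₁ : IsPHarmonic G p (h₁ : V → ℝ)) (hh₂ : IsPHarmonic G p (h₂ : V → ℝ)) {ε : ℝ}
    (hle : ∀ τ ∈ pHarmonicBoundary G hp o,
      |(gelfand G hp h₁ τ).re - (gelfand G hp h₂ τ).re| ≤ ε) (x : V) :
    |(h₁ : V → ℝ) x - (h₂ : V → ℝ) x| ≤ ε := by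
  have hsub : ∀ (a b : BD G hp) τ, (gelfand G hp (a - b) τ).re =
      (gelfand G hp a τ).re - (gelfand G hp b τ).re := by
    intro a b τ
    rw [gelfand_sub, Complex.sub_re]
  refine abs_sub_le_iff.2 ⟨sub_le_of_gelfand_sub_le hconn hne hh₁ hh₂ (fun τ hτ => ?_) x,
    sub_le_of_gelfand_sub_le hconn hne hh₂ hh₁ (fun τ hτ => ?_) x⟩
  · rw [hsub]
    exact (abs_sub_le_iff.1 (hle τ hτ)).1
  · rw [hsub]
    exact (abs_sub_le_iff.1 (hle τ hτ)).2

/-! ### The Dirichlet problem at the `p`-harmonic boundary -/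

/-- The restriction of Gelfand transforms to the `p`-harmonic boundary, as real functions. -/
def boundaryRestrict (G : SimpleGraph V) [G.LocallyFinite] (hp : 1 < p) (o : V) :
    BD G hp →ₐ[ℝ] C(pHarmonicBoundary G hp o, ℝ) where
  toFun f := ⟨fun τ => (gelfand G hp f τ).re,
    Complex.continuous_re.comp ((continuous_gelfand f).comp continuous_subtype_val)⟩
  map_one' := by
    ext τ
    simp [gelfand_one]
  map_zero' := by
    ext τ
    simp [gelfand]
  map_add' f g := by
    ext τ
    simp [gelfand]
  map_mul' f g := by
    ext τ
    have h := gelfand_im τ.1 f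
    simp only [gelfand] at h
    simp [gelfand, Complex.mul_re, h]
  commutes' c := by
    ext τ
    have h : algebraMap ℝ (BD G hp) c = c • 1 := Algebra.algebraMap_eq_smul_one c
    simp [h, gelfand_smul_one]

theorem boundaryRestrict_apply (hp : 1 < p) (o : V) (f : BD G hp)
    (τ : pHarmonicBoundary G hp o) :
    boundaryRestrict G hp o f τ = (gelfand G hp f τ).re :=
  rfl

/-- Stone–Weierstrass: distinct characters differ on some `k`, and their values are real. -/
theorem exists_boundaryRestrict_near (o : V) (f : C(pHarmonicBoundary G hp o, ℝ)) {ε : ℝ}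
    (hε : 0 < ε) : ∃ k : BD G hp, ∀ τ, |boundaryRestrict G hp o k τ - f τ| < ε := by
  have hsep : (boundaryRestrict G hp o).range.SeparatesPoints := by
    intro τ σ hne
    have h1 : ∃ k : BD G hp, gelfand G hp k τ ≠ gelfand G hp k σ := by
      by_contra! h
      exact hne (Subtype.ext (Subtype.ext (NonUnitalAlgHom.ext h)))
    obtain ⟨k, hk⟩ := h1
    refine ⟨_, ⟨boundaryRestrict G hp o k, ⟨k, rfl⟩, rfl⟩, fun h => hk ?_⟩
    exact Complex.ext h (by rw [gelfand_im, gelfand_im])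
  obtain ⟨⟨_, k, rfl⟩, hk⟩ :=
    ContinuousMap.exists_mem_subalgebra_near_continuousMap_of_separatesPoints _ hsep f ε hε
  refine ⟨k, fun τ => ?_⟩
  exact (ContinuousMap.norm_coe_le_norm _ τ).trans_lt hk

theorem exists_isPHarmonic_near [Countable V] (o : V) (f : C(pHarmonicBoundary G hp o, ℝ)) {ε : ℝ}
    (hε : 0 < ε) : ∃ h : BD G hp, IsPHarmonic G p (h : V → ℝ) ∧
      ∀ τ, |boundaryRestrict G hp o h τ - f τ| < ε := by
  obtain ⟨k, hk⟩ := exists_boundaryRestrict_near o f hε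
  obtain ⟨M, hM⟩ := k.2.2
  obtain ⟨h, hharm, hE, hhM, hcl⟩ := exists_royden_decomposition G hp o k.2.1 hM
  obtain ⟨h', rfl⟩ : ∃ h' : BD G hp, (h' : V → ℝ) = h := ⟨⟨h, hE, M, hhM⟩, rfl⟩
  refine ⟨h', hharm, fun τ => ?_⟩
  have h1 : gelfand G hp (k - h') τ = 0 := mem_pHarmonicBoundary_iff.1 τ.2 (k - h') hcl
  rw [gelfand_sub, sub_eq_zero] at h1
  rw [boundaryRestrict_apply, ← h1]
  exact hk τ

theorem IsPHarmonic.of_tendsto (hp : 1 < p) {g : ℕ → V → ℝ} {h : V → ℝ}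
    (hg : ∀ n, IsPHarmonic G p (g n)) (hlim : ∀ x, Tendsto (fun n => g n x) atTop (𝓝 (h x))) :
    IsPHarmonic G p h := by
  intro x
  have h1 : Tendsto (fun n => pLaplacian G p (g n) x) atTop (𝓝 (pLaplacian G p h x)) :=
    tendsto_finsetSum _ fun y _ =>
      ((continuous_signedPow hp).tendsto _).comp ((hlim y).sub (hlim x))
  simp only [hg _ x] at h1
  exact (tendsto_nhds_unique h1 tendsto_const_nhds)

theorem exists_isPHarmonic_tendsto [Countable V] (hconn : G.Connected) (o : V)
    (f : C(pHarmonicBoundary G hp o, ℝ)) : ∃ h : V → ℝ, IsPHarmonic G p h ∧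
      ∀ τ : pHarmonicBoundary G hp o,
        Tendsto h (comap (vertexChar G hp) (𝓝 (τ : Sp G hp))) (𝓝 (f τ)) := by
  -- The comparison principle needs a boundary point; without one there is nothing to prescribe.
  rcases (pHarmonicBoundary G hp o).eq_empty_or_nonempty with he | hne
  · refine ⟨fun _ => 0, fun x => by simp [pLaplacian], fun τ => ?_⟩
    exact absurd τ.2 (by simp [he])
  choose h hharm hnear using fun n : ℕ =>
    exists_isPHarmonic_near o f (show (0 : ℝ) < 1 / ((n : ℝ) + 1) by positivity)
  have hdist : ∀ n m x, |(h n : V → ℝ) x - (h m : V → ℝ) x| ≤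
      1 / ((n : ℝ) + 1) + 1 / ((m : ℝ) + 1) := by
    intro n m
    refine abs_sub_le_of_gelfand hconn hne (hharm n) (hharm m) fun τ hτ => ?_
    have h1 := hnear n ⟨τ, hτ⟩
    have h2 := hnear m ⟨τ, hτ⟩
    rw [boundaryRestrict_apply] at h1 h2
    refine (abs_sub_le _ (f ⟨τ, hτ⟩) _).trans (add_le_add h1.le ?_)
    rw [abs_sub_comm]
    exact h2.le
  have hsmall : ∀ ε : ℝ, 0 < ε → ∃ N : ℕ, ∀ n ≥ N, 1 / ((n : ℝ) + 1) < ε := fun ε hε => by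
    simpa [eventually_atTop] using
      (tendsto_one_div_add_atTop_nhds_zero_nat (𝕜 := ℝ)).eventually_lt_const hε
  have hcauchy : ∀ x, CauchySeq fun n => (h n : V → ℝ) x := by
    intro x
    refine Metric.cauchySeq_iff.2 fun ε hε => ?_
    obtain ⟨N, hN⟩ := hsmall (ε / 2) (half_pos hε)
    refine ⟨N, fun n hn m hm => ?_⟩
    rw [Real.dist_eq]
    linarith [hdist n m x, hN n hn, hN m hm]
  choose H hH using fun x => cauchySeq_tendsto_of_complete (hcauchy x)
  have hHdist : ∀ n x, |(h n : V → ℝ) x - H x| ≤ 1 / ((n : ℝ) + 1) := by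
    intro n x
    have h1 := ((hH x).const_sub ((h n : V → ℝ) x)).abs
    have h2 := (tendsto_one_div_add_atTop_nhds_zero_nat (𝕜 := ℝ)).const_add (1 / ((n : ℝ) + 1))
    rw [add_zero] at h2
    exact le_of_tendsto_of_tendsto' h1 h2 fun m => hdist n m x
  refine ⟨H, IsPHarmonic.of_tendsto hp hharm hH, fun τ => ?_⟩
  refine Metric.tendsto_nhds.2 fun ε hε => ?_
  obtain ⟨n, hn⟩ := hsmall (ε / 3) (by positivity)
  have hn := hn n le_rfl
  have hcont : Continuous fun σ : Sp G hp => (gelfand G hp (h n) σ).re :=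
    Complex.continuous_re.comp (continuous_gelfand _)
  have h1 := (hcont.tendsto (τ : Sp G hp)).comp (tendsto_comap (f := vertexChar G hp))
  -- The three thirds of `ε` bound `H - h n` at `y`, the oscillation of the transform of `h n` near
  -- `τ`, and its distance to `f τ`.
  filter_upwards [Metric.tendsto_nhds.1 h1 (ε / 3) (by positivity)] with y hy
  have hy' : |(h n : V → ℝ) y - (gelfand G hp (h n) τ).re| < ε / 3 := hy
  have h2 := hnear n τ
  rw [boundaryRestrict_apply] at h2
  have h3 := abs_lt.1 hy'
  have h4 := abs_lt.1 h2
  have h5 := abs_le.1 (hHdist n y)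
  rw [Real.dist_eq, abs_lt]
  constructor <;> linarith

end

end PRoyden

end

theorem theorem2p4 {V : Type*} [Countable V] [Infinite V]
    (G : SimpleGraph V) [G.LocallyFinite] (hconn : G.Connected)
    (hdeg : ∃ k : ℕ, ∀ x, G.degree x ≤ k)
    (p : ℝ) (hp : 1 < p) (o : V)
    (f : C(PRoyden.pHarmonicBoundary G hp o, ℝ)) :
    ∃ h : V → ℝ, PRoyden.IsPHarmonic G p h ∧
      -- `h` extends `f` continuously: `h(y) → f(x)` as the vertex `y` tends to `x`
      (∀ x : PRoyden.pHarmonicBoundary G hp o,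
        Tendsto h (comap (PRoyden.vertexChar G hp) (𝓝 (x : PRoyden.Sp G hp))) (𝓝 (f x))) ∧
      -- in particular along sequences
      (∀ (x : PRoyden.pHarmonicBoundary G hp o) (v : ℕ → V),
        Tendsto (fun n => PRoyden.vertexChar G hp (v n)) atTop (𝓝 (x : PRoyden.Sp G hp)) →
          Tendsto (fun n => h (v n)) atTop (𝓝 (f x))) := by
  obtain ⟨h, hharm, hlim⟩ := PRoyden.exists_isPHarmonic_tendsto hconn o f
  exact ⟨h, hharm, hlim, fun x v hv => (hlim x).comp (tendsto_comap_iff.2 hv)⟩
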